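/- For a real polynomial $f$ put $\|f\|=\max_{x\in[-1,1]}|f(x)|$, and for $P(x)=\sum_{n=0}^{d}a_nx^n$ put $P_{<k}(x)=\sum_{n<k}a_nx^n$ and $P_{\ge k}(x)=\sum_{n=0}^{d-k}a_{n+k}x^n$, so that $P=P_{<k}+x^kP_{\ge k}$. A *QSP sequence* with $t$ queries to a block encoding $U$ of a density matrix $\rho$ (a unitary with $\langle a_0|U|a_0\rangle=\rho$) is $S(\phi_0)\,U\,S(\phi_1)\,U^\dagger S(\phi_2)\,U\cdots S(\phi_t)$ ($U$ and $U^\dagger$ alternate), where $S(\phi)=e^{i\phi Z\otimes(2|a_0\rangle\langle a_0|-1)}$ and $Z$ acts on a QSP qubit; the QSP qubit and the block-encoding register are prepared in $|+,a_0\rangle$ and post-selected on $|+,a_0\rangle$. A *measurement* is one run of a circuit consisting of tests performed side by side on fresh copies of $\rho$, each test being either (i) a Hadamard test of one QSP sequence on one copy of $\rho$, or (ii) the parallel QSP circuit across $k$ threads: one QSP sequence on each of $k$ copies of $\rho$, followed by the generalized swap test (a Hadamard test of the cyclic shift of the $k$ systems). The width of a circuit is its number of registers, its query depth the maximal number of successive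 queries to $U$ or $U^\dagger$ in it. Circuits may be chosen at random, and the estimate is a classical function of all random choices and outcomes; the protocol depends only on $P$, $k$, $\epsilon$ and the dimension of $\rho$, not on $\rho$ or $U$. **Theorem.** There is a universal constant $C$ with the following property. Let $P$ be a real polynomial of degree $d$ and definite parity with $\|P\|\le1$, let $1\le k\le d$ with $k\equiv d \pmod 2$, and let $\epsilon>0$. For every dimension $D$ there is such a protocol, with circuits of width at most $Ck$ and query depth at most $\lfloor\frac{d-k}{2k}\rfloor+k-1$, that, for every density matrix $\rho$ of dimension $D$ and every block encoding $U$ of $\rho$, estimates $\operatorname{tr}(P(\rho))$ to additive error $\epsilon$ with probability at least $2/3$ and uses at most $$\left\lceil \frac{C}{\epsilon^2}\left(k\,\|P_{<k}\|^2+\frac{\|P_{\ge k}\|^2\,d^4(1+\sqrt2)^{4k}}{k^2}\right)\right\rceil$$ measurements. -/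

import Mathlib

open scoped BigOperators Matrix Polynomial ComplexOrder

/-! ### Polynomials -/

/-- The norm `max_{x ∈ [-1,1]} |f x|`. -/
noncomputable def unitNorm (f : ℝ[X]) : ℝ :=
  sSup ((fun x : ℝ => |f.eval x|) '' Set.Icc (-1) 1)

/-- `P_{<k}(x) = ∑_{n<k} a_n x^n`. -/
noncomputable def lowPart (k : ℕ) (P : ℝ[X]) : ℝ[X] :=
  ∑ n ∈ Finset.range k, Polynomial.monomial n (P.coeff n)

/-- `P_{≥k}(x) = ∑_{n=0}^{d-k} a_{n+k} x^n`, where `d = deg P`. -/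
noncomputable def highPart (k : ℕ) (P : ℝ[X]) : ℝ[X] :=
  ∑ n ∈ Finset.range (P.natDegree + 1 - k), Polynomial.monomial n (P.coeff (n + k))

/-- `P` is an even or an odd polynomial. -/
def HasDefiniteParity (P : ℝ[X]) : Prop :=
  P.comp (-Polynomial.X) = P ∨ P.comp (-Polynomial.X) = -P

/-! ### States and block encodings -/

/-- Density matrices. -/
def IsDensityMatrix {S : Type*} [Fintype S] (ρ : Matrix S S ℂ) : Prop :=
  ρ.PosSemidef ∧ ρ.trace = 1

/-- `U` is a unitary on (block-encoding register `A`) ⊗ (system `S`) whose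
`|a₀⟩⟨a₀|` block is `ρ`. -/
def IsBlockEncoding {A S : Type*} [Fintype A] [DecidableEq A] [Fintype S] [DecidableEq S]
    (a₀ : A) (U : Matrix (A × S) (A × S) ℂ) (ρ : Matrix S S ℂ) : Prop :=
  U ∈ Matrix.unitaryGroup (A × S) ℂ ∧ ∀ i j, U (a₀, i) (a₀, j) = ρ i j

/-! ### Quantum signal processing

The registers of a thread are a QSP qubit `Fin 2`, the block-encoding register `A`, and the
system `S`. -/

/-- A QSP sequence: the number of queries and the phases `φ₀, …, φ_queries`
(later values of `phase` are not used). -/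
structure QSPSeq where
  queries : ℕ
  phase : ℕ → ℝ

section Circuits

variable {A S : Type*} [Fintype A] [DecidableEq A] [Fintype S] [DecidableEq S]

/-- The signal-processing operator `exp(i φ Z ⊗ (2|a₀⟩⟨a₀| - 1))`, where `Z` acts on the
QSP qubit. -/
noncomputable def phaseGate (a₀ : A) (φ : ℝ) :
    Matrix (Fin 2 × (A × S)) (Fin 2 × (A × S)) ℂ :=
  Matrix.diagonal fun x =>
    Complex.exp (Complex.I *
      ((φ * (if x.1 = 0 then 1 else -1) * (if x.2.1 = a₀ then 1 else -1) : ℝ) : ℂ))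

/-- One query to the block encoding: the identity on the QSP qubit, and `U` or its
inverse, alternatingly, on the other registers. -/
noncomputable def queryGate (U : Matrix (A × S) (A × S) ℂ) (i : ℕ) :
    Matrix (Fin 2 × (A × S)) (Fin 2 × (A × S)) ℂ :=
  Matrix.kronecker (1 : Matrix (Fin 2) (Fin 2) ℂ) (if Even i then U else Uᴴ)

/-- The unitary `S(φ₀) U S(φ₁) U† S(φ₂) U ⋯ S(φ_t)` with `t` queries. -/
noncomputable def qspUnitary (a₀ : A) (U : Matrix (A × S) (A × S) ℂ) (φ : ℕ → ℝ) :
    ℕ → Matrix (Fin 2 × (A × S)) (Fin 2 × (A × S)) ℂ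
  | 0 => phaseGate a₀ (φ 0)
  | i + 1 => qspUnitary a₀ U φ i * queryGate U i * phaseGate a₀ (φ (i + 1))

/-- The block `⟨+, a₀| W |+, a₀⟩` of an operator on the registers of a thread. It is the Kraus
operator, on the system, of preparing `|+, a₀⟩`, applying `W`, and then measuring the QSP qubit
and the block-encoding register and finding `|+, a₀⟩`. -/
noncomputable def plusBlock (a₀ : A)
    (W : Matrix (Fin 2 × (A × S)) (Fin 2 × (A × S)) ℂ) : Matrix S S ℂ :=
  Matrix.of fun i j => (1 / 2 : ℂ) * ∑ c : Fin 2, ∑ c' : Fin 2, W (c, (a₀, i)) (c', (a₀, j))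

/-- Kraus operator of a Hadamard test of the unitary `W`: prepare a control qubit in `|+⟩`, apply
`W` controlled on it, measure it in the `|±⟩` basis. The operator is `(1 + W)/2` for the
outcome `+` and `(1 - W)/2` for the outcome `-`. -/
noncomputable def hadamardKraus {T : Type*} [DecidableEq T] (W : Matrix T T ℂ)
    (plus : Bool) : Matrix T T ℂ :=
  (1 / 2 : ℂ) • (1 + (if plus then 1 else -1 : ℂ) • W)

/-- The cyclic shift `|ψ₁⟩|ψ₂⟩⋯|ψ_k⟩ ↦ |ψ_k⟩|ψ₁⟩⋯|ψ_{k-1}⟩` on `k` copies of the system. -/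
noncomputable def cyclicShift (S : Type*) [DecidableEq S] (k : ℕ) :
    Matrix (Fin k → S) (Fin k → S) ℂ :=
  Matrix.of fun f g => if ∀ i, f (finRotate k i) = g i then 1 else 0

/-- The tensor product of `k` operators on the system. -/
noncomputable def tensorProd {S : Type*} {k : ℕ} (σ : Fin k → Matrix S S ℂ) :
    Matrix (Fin k → S) (Fin k → S) ℂ :=
  Matrix.of fun f g => ∏ i, σ i (f i) (g i)

/-- Born rule: the probability of the outcome with Kraus operator `K` in the (possibly
subnormalized) state `σ`. -/
noncomputable def bornProb {T : Type*} [Fintype T] (K σ : Matrix T T ℂ) : ℝ :=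
  (K * σ * Kᴴ).trace.re

/-- The two kinds of tests, each acting on fresh copies of the state.
* `hadamard s`: Hadamard test of the QSP sequence `s` on one copy, with post-selection of
  the QSP qubit and the block-encoding register on `|+, a₀⟩`.
* `parallel s`: the parallel QSP circuit across `k` threads: thread `j` applies the QSP
  sequence `s j` to its own copy and is post-selected on `|+, a₀⟩`; then the generalized
  swap test, as a Hadamard test of the cyclic shift, is applied to the `k` systems. -/
inductive QSPTest (k : ℕ) where
  | hadamard (s : QSPSeq)
  | parallel (s : Fin k → QSPSeq)

/-- Number of sequential queries to the block encoding. -/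
def QSPTest.queryDepth {k : ℕ} : QSPTest k → ℕ
  | .hadamard s => s.queries
  | .parallel s => Finset.univ.sup fun j => (s j).queries

/-- Number of registers: three for each thread (QSP qubit, block-encoding register, system) and
the control qubit of the Hadamard or swap test. -/
def QSPTest.width {k : ℕ} : QSPTest k → ℕ
  | .hadamard _ => 4
  | .parallel _ => 3 * k + 1

/-- Probability that all post-selections succeed and the control qubit is found in
`|+⟩` (`plus = true`) or `|-⟩` (`plus = false`). -/
noncomputable def QSPTest.passProb {k : ℕ} (a₀ : A) (U : Matrix (A × S) (A × S) ℂ)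
    (ρ : Matrix S S ℂ) (T : QSPTest k) (plus : Bool) : ℝ :=
  match T with
  | .hadamard s =>
      bornProb (plusBlock a₀ (hadamardKraus (qspUnitary a₀ U s.phase s.queries) plus)) ρ
  | .parallel s =>
      bornProb (hadamardKraus (cyclicShift S k) plus)
        (tensorProd fun j =>
          plusBlock a₀ (qspUnitary a₀ U (s j).phase (s j).queries) * ρ *
            (plusBlock a₀ (qspUnitary a₀ U (s j).phase (s j).queries))ᴴ)

/-- Outcome distribution of a test: `1` and `-1` are the two outcomes of the control qubit after
successful post-selection, `0` is a failed post-selection. -/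
noncomputable def QSPTest.prob {k : ℕ} (a₀ : A) (U : Matrix (A × S) (A × S) ℂ)
    (ρ : Matrix S S ℂ) (T : QSPTest k) : SignType → ℝ
  | .pos => T.passProb a₀ U ρ true
  | .neg => T.passProb a₀ U ρ false
  | .zero => 1 - T.passProb a₀ U ρ true - T.passProb a₀ U ρ false

end Circuits

/-! ### Estimation protocols -/

/-- A protocol that runs `runs` circuits and processes the outcomes classically. For the `n`-th run a
label `l : Fin labels` is sampled, independently, with probability `weight n l`; the
circuit of that run then consists of the tests `circuit n l 0, circuit n l 1, …`, carried out
side by side on disjoint registers. The estimate is computed from the sampled labels and all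
the outcomes. Neither the state nor its block encoding enters these data. -/
structure QSPProtocol (k : ℕ) where
  runs : ℕ
  labels : ℕ
  tests : ℕ
  weight : Fin runs → Fin labels → ℝ
  weight_nonneg : ∀ n l, 0 ≤ weight n l
  weight_sum : ∀ n, ∑ l, weight n l = 1
  circuit : Fin runs → Fin labels → Fin tests → QSPTest k
  estimate : (Fin runs → Fin labels × (Fin tests → SignType)) → ℝ

/-- Every circuit that the protocol may run has at most `w` registers. -/
def QSPProtocol.WidthLE {k : ℕ} (p : QSPProtocol k) (w : ℝ) : Prop :=
  ∀ n l, ((∑ t, (p.circuit n l t).width : ℕ) : ℝ) ≤ w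

/-- Every circuit that the protocol may run has query depth at most `q`. -/
def QSPProtocol.QueryDepthLE {k : ℕ} (p : QSPProtocol k) (q : ℕ) : Prop :=
  ∀ n l t, (p.circuit n l t).queryDepth ≤ q

section Run

variable {A S : Type*} [Fintype A] [DecidableEq A] [Fintype S] [DecidableEq S]

/-- Probability of a complete record of labels and outcomes. -/
noncomputable def QSPProtocol.recordProb {k : ℕ} (p : QSPProtocol k) (a₀ : A)
    (U : Matrix (A × S) (A × S) ℂ) (ρ : Matrix S S ℂ)
    (r : Fin p.runs → Fin p.labels × (Fin p.tests → SignType)) : ℝ :=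
  ∏ n, p.weight n (r n).1 * ∏ t, (p.circuit n (r n).1 t).prob a₀ U ρ ((r n).2 t)

open Classical in
/-- Probability that the estimate is within `ε` of `w`. -/
noncomputable def QSPProtocol.successProb {k : ℕ} (p : QSPProtocol k) (a₀ : A)
    (U : Matrix (A × S) (A × S) ℂ) (ρ : Matrix S S ℂ) (w : ℂ) (ε : ℝ) : ℝ :=
  ∑ r : Fin p.runs → Fin p.labels × (Fin p.tests → SignType),
    if ‖((p.estimate r : ℝ) : ℂ) - w‖ ≤ ε then p.recordProb a₀ U ρ r else 0

end Run

/-! Write `P(x) = a₀ + x L(x) + x^k H(x)` with `x L = P_{<k} - a₀` and `H = P_{≥k}`, so that `tr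
P(ρ) = D a₀ + tr(ρ L(ρ)) + tr(ρ^k H(ρ))`, and the first summand is known. A sequence with `a + b`
queries has block exactly `T_a(ρ) T_b(ρ)` (`plusBlock_chebSeq`). Its Hadamard test with `b = 0` has
mean `tr(ρ T_a(ρ))`, which serves `L`, expanded in `T_0, …, T_{k-1}`. The parallel circuit has mean
`tr(ρ^k ∏_j (T_{a_j} T_{b_j})²(ρ))`, so `H` must be a signed combination of such products with every
`a_j + b_j` within the query depth.

By parity `H` is even, hence a combination of polynomials `T_{2n}` with `2n ≤ d - k`. Put `n = kM +
r` with `r < k`. Then `T_{2kM} T_{2r} = T_{2k}(T_M) (2 T_r² - 1)` is a combination of even powers of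
`T_M`, times `T_r²` or `1`. The powers are spread over the threads, so depth `M + r` suffices, and
the coefficients of `T_{2k}` cost a factor `(1 + √2)^{2k}`. The identity `T_{2n} = 2 T_{2kM} T_{2r}
- T_{2(kM - r)}` lowers the quotient `M` by one, so induction on `M` handles all `n`
(`hasExpansion_T_two_mul`). Summing up gives total weight `Λ` of order `‖H‖ (1 + √2)^{2k} d² / k`
(`hasExpansion_highPart`).

Each run samples one product with probability proportional to its weight and performs the `k`
Hadamard tests beside it. The resulting estimator is unbiased with variance at most `Λ² + ∑ c_t²`,
where `c_t` are the coefficients of `L` (`run_moments`). Discrete orthogonality at the zeros of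
`T_{2k}` yields `∑ c_t² ≤ 64 k ‖P_{<k}‖²` (`exists_lowPart_expansion`), and Chebyshev's inequality
bounds the number of runs. -/

/-! ### Encoded blocks of QSP sequences. -/

/-- The signal-processing operator for a fixed value of the QSP qubit. -/
noncomputable def blockPhase {A : Type*} (S : Type*) [DecidableEq A] [DecidableEq S] (a₀ : A) (φ : ℝ) :
    Matrix (A × S) (A × S) ℂ :=
  Matrix.diagonal fun y => Complex.exp (Complex.I * ((φ * (if y.1 = a₀ then 1 else -1) : ℝ) : ℂ))

/-- The value of `Z` on a basis state of the QSP qubit. -/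
noncomputable def zSign (c : Fin 2) : ℝ := if c = 0 then 1 else -1

lemma phaseGate_apply {A S : Type*} [DecidableEq A] [DecidableEq S] (a₀ : A) (φ : ℝ) (c c' : Fin 2) (x y : A × S) :
    phaseGate a₀ φ (c, x) (c', y) =
      if c = c' then blockPhase S a₀ (zSign c * φ) x y else 0 := by
  by_cases hc : c = c'
  · subst hc
    by_cases hxy : x = y
    · subst hxy
      simp only [phaseGate, blockPhase, Matrix.diagonal_apply_eq, if_true, zSign]
      congr 4
      ring
    · simp [phaseGate, blockPhase, hxy]
  · simp [phaseGate, hc]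

section QSPBlocks

variable {A S : Type*} [Fintype A] [DecidableEq A] [Fintype S] [DecidableEq S]

/-- The query with index `i`. -/
def altQuery (U : Matrix (A × S) (A × S) ℂ) (i : ℕ) : Matrix (A × S) (A × S) ℂ :=
  if Even i then U else Uᴴ

/-- The QSP sequence for a fixed value of the QSP qubit. -/
noncomputable def qspBlock (a₀ : A) (U : Matrix (A × S) (A × S) ℂ) (φ : ℕ → ℝ) :
    ℕ → Matrix (A × S) (A × S) ℂ
  | 0 => blockPhase S a₀ (φ 0)
  | i + 1 => qspBlock a₀ U φ i * altQuery U i * blockPhase S a₀ (φ (i + 1))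

lemma qspUnitary_apply (a₀ : A) (U : Matrix (A × S) (A × S) ℂ) (φ : ℕ → ℝ) (n : ℕ)
    (c c' : Fin 2) (x y : A × S) :
    qspUnitary a₀ U φ n (c, x) (c', y) =
      if c = c' then qspBlock a₀ U (fun j => zSign c * φ j) n x y else 0 := by
  induction n generalizing c c' x y with
  | zero => exact phaseGate_apply a₀ (φ 0) c c' x y
  | succ n ih =>
    have h1 : ∀ (c c' : Fin 2) (x y : A × S),
        (qspUnitary a₀ U φ n * queryGate U n) (c, x) (c', y) =
          if c = c' then (qspBlock a₀ U (fun j => zSign c * φ j) n * altQuery U n) x y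
            else 0 := by
      intro c c' x y
      rw [Matrix.mul_apply, Fintype.sum_prod_type]
      simp only [ih, queryGate, Matrix.kronecker, Matrix.kroneckerMap_apply, Matrix.one_apply,
        Matrix.mul_apply (M := qspBlock _ _ _ _), altQuery]
      by_cases hc : c = c'
      · subst hc
        rw [Finset.sum_eq_single c]
        · simp
        · intro b _ hb
          simp [hb.symm]
        · simp
      · rw [if_neg hc]
        refine Finset.sum_eq_zero fun b _ => Finset.sum_eq_zero fun z _ => ?_
        by_cases hb : c = b
        · subst hb
          simp [hc]
        · simp [hb]
    rw [qspUnitary, Matrix.mul_apply, Fintype.sum_prod_type]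
    simp only [h1, phaseGate_apply]
    by_cases hc : c = c'
    · subst hc
      rw [if_pos rfl, qspBlock, Matrix.mul_apply, Finset.sum_eq_single c]
      · simp
      · intro b _ hb
        simp [hb.symm]
      · simp
    · rw [if_neg hc]
      refine Finset.sum_eq_zero fun b _ => Finset.sum_eq_zero fun z _ => ?_
      by_cases hb : c = b
      · subst hb
        simp [hc]
      · simp [hb]

/-- The `⟨a₀| · |a₀⟩` block. -/
def encBlock (a₀ : A) (M : Matrix (A × S) (A × S) ℂ) : Matrix S S ℂ :=
  M.submatrix (fun i => (a₀, i)) (fun i => (a₀, i))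

lemma plusBlock_qspUnitary (a₀ : A) (U : Matrix (A × S) (A × S) ℂ) (φ : ℕ → ℝ) (n : ℕ) :
    plusBlock a₀ (qspUnitary a₀ U φ n) =
      (1 / 2 : ℂ) • (encBlock a₀ (qspBlock a₀ U φ n) +
        encBlock a₀ (qspBlock a₀ U (fun j => -φ j) n)) := by
  ext i j
  simp [plusBlock, encBlock, qspUnitary_apply, zSign, Fin.sum_univ_two]

lemma encBlock_mul_blockPhase (a₀ : A) (M : Matrix (A × S) (A × S) ℂ) (φ : ℝ) :
    encBlock a₀ (M * blockPhase S a₀ φ) = Complex.exp (φ * Complex.I) • encBlock a₀ M := by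
  ext i j
  simp [encBlock, blockPhase, Matrix.mul_diagonal, mul_comm]

/-- The phase operator is `e^{-iφ} + 2i sin φ |a₀⟩⟨a₀|`. The scalar part leaves the product intact,
and the projector splits it into a product of two blocks. -/
lemma encBlock_mul_blockPhase_mul (a₀ : A) (M N : Matrix (A × S) (A × S) ℂ) (φ : ℝ) :
    encBlock a₀ (M * blockPhase S a₀ φ * N) =
      Complex.exp (-(φ * Complex.I)) • encBlock a₀ (M * N) +
        (2 * Complex.I * Complex.sin φ) • (encBlock a₀ M * encBlock a₀ N) := by
  ext i j
  simp only [encBlock, blockPhase, Matrix.submatrix_apply, Matrix.add_apply, Matrix.smul_apply,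
    Matrix.mul_apply (N := N), Matrix.mul_diagonal, Matrix.mul_apply (M := M.submatrix _ _),
    smul_eq_mul, Fintype.sum_prod_type]
  rw [← Finset.add_sum_erase _ _ (Finset.mem_univ a₀),
    ← Finset.add_sum_erase (a := a₀) (f := fun x => ∑ y, M (a₀, i) (x, y) * N (x, y) (a₀, j)) _
      (Finset.mem_univ a₀), mul_add, add_right_comm]
  congr 1
  · rw [Finset.mul_sum, Finset.mul_sum, ← Finset.sum_add_distrib]
    refine Finset.sum_congr rfl fun y _ => ?_
    have h : Complex.exp (Complex.I * φ) =
        Complex.exp (-(φ * Complex.I)) + 2 * Complex.I * Complex.sin φ := by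
      rw [mul_comm, ← neg_mul, Complex.exp_mul_I, Complex.exp_mul_I, Complex.cos_neg,
        Complex.sin_neg]
      ring
    simp only [if_true, mul_one, h]
    ring
  · rw [Finset.mul_sum]
    refine Finset.sum_congr rfl fun x hx => ?_
    rw [Finset.mul_sum]
    refine Finset.sum_congr rfl fun y _ => ?_
    have hx : x ≠ a₀ := (Finset.mem_erase.mp hx).1
    simp only [if_neg hx]
    rw [show Complex.I * ((φ * -1 : ℝ) : ℂ) = -(φ * Complex.I) by push_cast; ring]
    ring

variable {a₀ : A} {U : Matrix (A × S) (A × S) ℂ} {ρ : Matrix S S ℂ}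

lemma altQuery_mul_succ (hU : IsBlockEncoding a₀ U ρ) (n : ℕ) :
    altQuery U n * altQuery U (n + 1) = 1 := by
  by_cases h : Even n
  · simpa [altQuery, h, Nat.even_add_one, Matrix.star_eq_conjTranspose] using
      Matrix.mem_unitaryGroup_iff.mp hU.1
  · simpa [altQuery, h, Nat.even_add_one, Matrix.star_eq_conjTranspose] using
      Matrix.mem_unitaryGroup_iff'.mp hU.1

lemma encBlock_altQuery (hU : IsBlockEncoding a₀ U ρ) (hρ : ρ.IsHermitian) (n : ℕ) :
    encBlock a₀ (altQuery U n) = ρ := by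
  ext i j
  by_cases h : Even n
  · simp [altQuery, h, encBlock, hU.2]
  · simp only [altQuery, h, encBlock, if_false, Matrix.submatrix_apply,
      Matrix.conjTranspose_apply, hU.2]
    exact hρ.apply i j

lemma encBlock_qspBlock_succ (φ : ℕ → ℝ) (n : ℕ) :
    encBlock a₀ (qspBlock a₀ U φ (n + 1)) =
      Complex.exp (φ (n + 1) * Complex.I) • encBlock a₀ (qspBlock a₀ U φ n * altQuery U n) := by
  rw [qspBlock, encBlock_mul_blockPhase]

/-- Adjacent queries cancel in the scalar part of the phase operator. Together with
`encBlock_qspBlock_succ` this closes a recursion on the pair of blocks without and with one further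
query. -/
lemma encBlock_qspBlock_succ_mul (hU : IsBlockEncoding a₀ U ρ) (hρ : ρ.IsHermitian)
    (φ : ℕ → ℝ) (n : ℕ) :
    encBlock a₀ (qspBlock a₀ U φ (n + 1) * altQuery U (n + 1)) =
      Complex.exp (-(φ (n + 1) * Complex.I)) • encBlock a₀ (qspBlock a₀ U φ n) +
        (2 * Complex.I * Complex.sin (φ (n + 1))) •
          (encBlock a₀ (qspBlock a₀ U φ n * altQuery U n) * ρ) := by
  rw [qspBlock, encBlock_mul_blockPhase_mul, encBlock_altQuery hU hρ, Matrix.mul_assoc,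
    altQuery_mul_succ hU, Matrix.mul_one]

lemma encBlock_blockPhase (φ : ℝ) :
    encBlock a₀ (blockPhase S a₀ φ) = Complex.exp (φ * Complex.I) • (1 : Matrix S S ℂ) := by
  have := encBlock_mul_blockPhase a₀ (1 : Matrix (A × S) (A × S) ℂ) φ
  rw [Matrix.one_mul] at this
  rw [this]
  congr 1
  ext i j
  simp [encBlock, Matrix.one_apply]

lemma encBlock_blockPhase_mul_altQuery (hU : IsBlockEncoding a₀ U ρ) (hρ : ρ.IsHermitian)
    (φ : ℝ) (n : ℕ) :
    encBlock a₀ (blockPhase S a₀ φ * altQuery U n) = Complex.exp (φ * Complex.I) • ρ := by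
  have h : encBlock a₀ (1 : Matrix (A × S) (A × S) ℂ) = 1 := by
    ext i j
    simp [encBlock, Matrix.one_apply]
  have := encBlock_mul_blockPhase_mul a₀ 1 (altQuery U n) φ
  rw [Matrix.one_mul, Matrix.one_mul, h, Matrix.one_mul, encBlock_altQuery hU hρ] at this
  rw [this, ← add_smul, ← neg_mul, Complex.exp_mul_I, Complex.exp_mul_I, Complex.cos_neg,
        Complex.sin_neg]
  congr 1
  ring

end QSPBlocks

/-! ### QSP sequences for products of Chebyshev polynomials. -/

/-- Phases for which the QSP sequence with `a + 1 + b` queries implements `T_{a+1} T_b`. -/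
noncomputable def chebPhase (a b : ℕ) (j : ℕ) : ℝ :=
  if j = 0 then -(Real.pi / 4) - (a + b : ℕ) * (Real.pi / 2)
  else if j = a + 1 then Real.pi / 4 else Real.pi / 2

/-- A QSP sequence implementing `T_a T_b`. -/
noncomputable def chebSeq (a b : ℕ) : QSPSeq where
  queries := a + b
  -- `chebPhase` needs a positive first index, so for `a = 0` the two factors are exchanged, and
  -- `T_0 T_0` gets zero phases.
  phase := if a = 0 then (if b = 0 then 0 else chebPhase (b - 1) 0) else chebPhase (a - 1) b

/-- The polynomial implemented by `chebSeq a b`. -/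
noncomputable def chebProd (a b : ℕ) : ℝ[X] :=
  Polynomial.Chebyshev.T ℝ a * Polynomial.Chebyshev.T ℝ b

section ChebyshevSequences

variable {A S : Type*} [Fintype A] [DecidableEq A] [Fintype S] [DecidableEq S]
variable {a₀ : A} {U : Matrix (A × S) (A × S) ℂ} {ρ : Matrix S S ℂ}

lemma aeval_T_mul_self (ρ : Matrix S S ℂ) (n : ℤ) :
    Polynomial.aeval ρ (Polynomial.Chebyshev.T ℝ n) * ρ = (1 / 2 : ℂ) •
      (Polynomial.aeval ρ (Polynomial.Chebyshev.T ℝ (n + 1)) +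
        Polynomial.aeval ρ (Polynomial.Chebyshev.T ℝ (n - 1))) := by
  have h : Polynomial.aeval ρ (Polynomial.Chebyshev.T ℝ (n + 1)) =
      (2 : ℂ) • (Polynomial.aeval ρ (Polynomial.Chebyshev.T ℝ n) * ρ) -
        Polynomial.aeval ρ (Polynomial.Chebyshev.T ℝ (n - 1)) := by
    rw [Polynomial.Chebyshev.T_add_one,
      show 2 * Polynomial.X * Polynomial.Chebyshev.T ℝ n =
        Polynomial.Chebyshev.T ℝ n * Polynomial.X + Polynomial.Chebyshev.T ℝ n * Polynomial.X by
        ring, map_sub, map_add, map_mul, Polynomial.aeval_X, two_smul]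
  rw [h]
  module

/-- At phase `sπ/2` the recursion for the pair of blocks is `T_{n+2} = 2x T_{n+1} - T_n` up to a
factor `J = s i`. -/
lemma encBlock_qspBlock_chebPhase_low (hU : IsBlockEncoding a₀ U ρ) (hρ : ρ.IsHermitian)
    {J : ℂ} {s : ℝ} (hexp : Complex.exp ((s * (Real.pi / 2) : ℝ) * Complex.I) = J)
    (hexp' : Complex.exp (-((s * (Real.pi / 2) : ℝ) * Complex.I)) = -J)
    (hsin : Complex.I * Complex.sin ((s * (Real.pi / 2) : ℝ)) = J) (a b n : ℕ) (hn : n ≤ a) :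
    encBlock a₀ (qspBlock a₀ U (fun j => s * chebPhase a b j) n) =
      (Complex.exp ((s * chebPhase a b 0 : ℝ) * Complex.I) * J ^ n) •
        Polynomial.aeval ρ (Polynomial.Chebyshev.T ℝ n) ∧
    encBlock a₀ (qspBlock a₀ U (fun j => s * chebPhase a b j) n * altQuery U n) =
      (Complex.exp ((s * chebPhase a b 0 : ℝ) * Complex.I) * J ^ n) •
        Polynomial.aeval ρ (Polynomial.Chebyshev.T ℝ (n + 1)) := by
  induction n with
  | zero =>
    simp only [qspBlock, encBlock_blockPhase, encBlock_blockPhase_mul_altQuery hU hρ]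
    simp
  | succ n ih =>
    obtain ⟨h1, h2⟩ := ih (by omega)
    have hph : chebPhase a b (n + 1) = Real.pi / 2 := by
      rw [chebPhase, if_neg (by omega), if_neg (by omega)]
    rw [encBlock_qspBlock_succ, encBlock_qspBlock_succ_mul hU hρ, h1, h2]
    simp only [hph]
    rw [hexp, hexp', mul_assoc 2 Complex.I, hsin, smul_mul_assoc, aeval_T_mul_self,
      add_sub_cancel_right]
    constructor
    · push_cast
      module
    · push_cast
      module

/-- The phase `π/4` at index `a + 1` splits the sequence into two branches. The later phases `π/2`
move one branch down and the other up by one degree per query. Integer indices of `T` let the lower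
branch pass below zero without a case distinction. -/
lemma encBlock_qspBlock_chebPhase_high (hU : IsBlockEncoding a₀ U ρ) (hρ : ρ.IsHermitian)
    {J c : ℂ} {s : ℝ}
    (hexp : Complex.exp ((s * (Real.pi / 2) : ℝ) * Complex.I) = J)
    (hexp' : Complex.exp (-((s * (Real.pi / 2) : ℝ) * Complex.I)) = -J)
    (hsin : Complex.I * Complex.sin ((s * (Real.pi / 2) : ℝ)) = J)
    (kexp : Complex.exp ((s * (Real.pi / 4) : ℝ) * Complex.I) = c + c * J)
    (kexp' : Complex.exp (-((s * (Real.pi / 4) : ℝ) * Complex.I)) = c - c * J)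
    (ksin : Complex.I * Complex.sin ((s * (Real.pi / 4) : ℝ)) = c * J) (a b m : ℕ) :
    encBlock a₀ (qspBlock a₀ U (fun j => s * chebPhase a b j) (a + 1 + m)) =
      (Complex.exp ((s * chebPhase a b 0 : ℝ) * Complex.I) * J ^ (a + m) * c) •
        (Polynomial.aeval ρ (Polynomial.Chebyshev.T ℝ (a + 1 - m)) +
          J • Polynomial.aeval ρ (Polynomial.Chebyshev.T ℝ (a + 1 + m))) ∧
    encBlock a₀ (qspBlock a₀ U (fun j => s * chebPhase a b j) (a + 1 + m) *
        altQuery U (a + 1 + m)) =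
      (Complex.exp ((s * chebPhase a b 0 : ℝ) * Complex.I) * J ^ (a + m) * c) •
        (Polynomial.aeval ρ (Polynomial.Chebyshev.T ℝ (a - m)) +
          J • Polynomial.aeval ρ (Polynomial.Chebyshev.T ℝ (a + 2 + m))) := by
  induction m with
  | zero =>
    obtain ⟨h1, h2⟩ :=
      encBlock_qspBlock_chebPhase_low hU hρ hexp hexp' hsin a b a le_rfl
    have hph : chebPhase a b (a + 1) = Real.pi / 4 := by
      rw [chebPhase, if_neg (by omega), if_pos rfl]
    simp only [add_zero]
    rw [encBlock_qspBlock_succ, encBlock_qspBlock_succ_mul hU hρ, h1, h2]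
    simp only [hph]
    rw [kexp, kexp', mul_assoc 2 Complex.I, ksin, smul_mul_assoc, aeval_T_mul_self,
      add_sub_cancel_right, show (a + 1 + 1 : ℤ) = a + 2 by ring]
    simp only [Nat.cast_zero, sub_zero, add_zero]
    constructor <;> module
  | succ m ih =>
    obtain ⟨h1, h2⟩ := ih
    have hph : chebPhase a b (a + 1 + m + 1) = Real.pi / 2 := by
      rw [chebPhase, if_neg (by omega), if_neg (by omega)]
    rw [← add_assoc, ← add_assoc a m 1, encBlock_qspBlock_succ, encBlock_qspBlock_succ_mul hU hρ,
      h1, h2]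
    simp only [hph]
    rw [hexp, hexp', mul_assoc 2 Complex.I, hsin, smul_mul_assoc, add_mul, smul_mul_assoc,
      aeval_T_mul_self, aeval_T_mul_self, show (a + 2 + m - 1 : ℤ) = a + 1 + m by ring,
      show (a + 2 + m + 1 : ℤ) = a + 2 + (m + 1 : ℕ) by push_cast; ring,
      show (a - m + 1 : ℤ) = a + 1 - m by ring,
      show (a - m - 1 : ℤ) = a - (m + 1 : ℕ) by push_cast; ring,
      show (a + 1 - (m + 1 : ℕ) : ℤ) = a - m by push_cast; ring,
      show (a + 1 + (m + 1 : ℕ) : ℤ) = a + 2 + m by push_cast; ring]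
    constructor <;> module

lemma encBlock_qspBlock_chebPhase (hU : IsBlockEncoding a₀ U ρ) (hρ : ρ.IsHermitian)
    {s : ℝ} (hs : s = 1 ∨ s = -1) (a b : ℕ) :
    encBlock a₀ (qspBlock a₀ U (fun j => s * chebPhase a b j) (a + 1 + b)) =
      (1 / 2 * (1 - s * Complex.I)) •
        (Polynomial.aeval ρ (Polynomial.Chebyshev.T ℝ (a + 1 - b)) +
          (s * Complex.I) • Polynomial.aeval ρ (Polynomial.Chebyshev.T ℝ (a + 1 + b))) := by
  have hss : (s : ℂ) * s = 1 := by
    rcases hs with rfl | rfl <;> simp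
  have hsin : Complex.I * Complex.sin ((s * (Real.pi / 2) : ℝ)) = s * Complex.I := by
    rw [← Complex.ofReal_sin]
    rcases hs with rfl | rfl <;> simp
  have hcos : Complex.cos ((s * (Real.pi / 2) : ℝ)) = 0 := by
    rw [← Complex.ofReal_cos]
    rcases hs with rfl | rfl <;> simp
  have ksin : Complex.I * Complex.sin ((s * (Real.pi / 4) : ℝ)) =
      ((√2 / 2 : ℝ) : ℂ) * (s * Complex.I) := by
    rw [← Complex.ofReal_sin]
    rcases hs with rfl | rfl <;> simp [mul_comm]
  have kcos : Complex.cos ((s * (Real.pi / 4) : ℝ)) = ((√2 / 2 : ℝ) : ℂ) := by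
    rw [← Complex.ofReal_cos]
    rcases hs with rfl | rfl <;> simp
  have hexp : Complex.exp ((s * (Real.pi / 2) : ℝ) * Complex.I) = s * Complex.I := by
    rw [Complex.exp_mul_I, hcos]
    linear_combination hsin
  have hexp' : Complex.exp (-((s * (Real.pi / 2) : ℝ) * Complex.I)) = -(s * Complex.I) := by
    rw [← neg_mul, Complex.exp_mul_I, Complex.cos_neg, Complex.sin_neg, hcos]
    linear_combination -hsin
  have kexp : Complex.exp ((s * (Real.pi / 4) : ℝ) * Complex.I) =
      ((√2 / 2 : ℝ) : ℂ) + ((√2 / 2 : ℝ) : ℂ) * (s * Complex.I) := by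
    rw [Complex.exp_mul_I, kcos]
    linear_combination ksin
  have kexp' : Complex.exp (-((s * (Real.pi / 4) : ℝ) * Complex.I)) =
      ((√2 / 2 : ℝ) : ℂ) - ((√2 / 2 : ℝ) : ℂ) * (s * Complex.I) := by
    rw [← neg_mul, Complex.exp_mul_I, Complex.cos_neg, Complex.sin_neg, kcos]
    linear_combination -ksin
  have hc : ((√2 / 2 : ℝ) : ℂ) * ((√2 / 2 : ℝ) : ℂ) = 1 / 2 := by
    rw [← Complex.ofReal_mul, div_mul_div_comm, Real.mul_self_sqrt (by norm_num)]
    norm_num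
  -- The initial phase is chosen to cancel `J^(a+b)` and leave `e^{-isπ/4}`.
  have hg : Complex.exp ((s * chebPhase a b 0 : ℝ) * Complex.I) * (s * Complex.I) ^ (a + b) =
      ((√2 / 2 : ℝ) : ℂ) - ((√2 / 2 : ℝ) : ℂ) * (s * Complex.I) := by
    rw [← hexp, ← Complex.exp_nat_mul, ← Complex.exp_add, hexp, ← kexp']
    congr 1
    simp only [chebPhase, if_true]
    push_cast
    ring
  rw [(encBlock_qspBlock_chebPhase_high hU hρ hexp hexp' hsin kexp kexp' ksin a b b).1, hg]
  congr 1
  linear_combination (1 - s * Complex.I) * hc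

/-- Preparing and finding `|+⟩` averages over `s = ±1`. In `(1 - s i)(X + s i Y)` only `X + Y`
survives, and half the sum of `T_{a+1-b}` and `T_{a+1+b}` is the product `T_{a+1} T_b`. -/
lemma plusBlock_chebPhase (hU : IsBlockEncoding a₀ U ρ) (hρ : ρ.IsHermitian) (a b : ℕ) :
    plusBlock a₀ (qspUnitary a₀ U (chebPhase a b) (a + 1 + b)) =
      Polynomial.aeval ρ
        (Polynomial.Chebyshev.T ℝ (a + 1 : ℕ) * Polynomial.Chebyshev.T ℝ b) := by
  have h1 := encBlock_qspBlock_chebPhase (a₀ := a₀) hU hρ (Or.inl rfl) a b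
  have h2 := encBlock_qspBlock_chebPhase (a₀ := a₀) hU hρ (Or.inr rfl) a b
  simp only [one_mul, neg_one_mul] at h1 h2
  have h3 : Polynomial.aeval ρ
      (Polynomial.Chebyshev.T ℝ (a + 1 : ℕ) * Polynomial.Chebyshev.T ℝ b) = (1 / 2 : ℂ) •
      (Polynomial.aeval ρ (Polynomial.Chebyshev.T ℝ (a + 1 - b)) +
          Polynomial.aeval ρ (Polynomial.Chebyshev.T ℝ (a + 1 + b))) := by
    have := congrArg (Polynomial.aeval ρ)
      (Polynomial.Chebyshev.T_mul_T ℝ ((a + 1 : ℕ) : ℤ) (b : ℤ))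
    rw [mul_assoc, two_mul, map_add, map_add] at this
    push_cast at this ⊢
    rw [add_comm (Polynomial.aeval ρ (Polynomial.Chebyshev.T ℝ (a + 1 - b))), ← this]
    module
  rw [plusBlock_qspUnitary, h1, h2, h3]
  match_scalars
  · ring
  · linear_combination (-1/2) * Complex.I_mul_I

lemma plusBlock_chebSeq (hU : IsBlockEncoding a₀ U ρ) (hρ : ρ.IsHermitian) (a b : ℕ) :
    plusBlock a₀ (qspUnitary a₀ U (chebSeq a b).phase (chebSeq a b).queries) =
      Polynomial.aeval ρ (chebProd a b) := by
  rw [chebProd]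
  rcases a with _ | a
  · rcases b with _ | b
    · ext i j
      simp [chebSeq, plusBlock_qspUnitary, qspBlock, encBlock_blockPhase]
      ring
    · have := plusBlock_chebPhase (a₀ := a₀) hU hρ b 0
      rw [mul_comm (Polynomial.Chebyshev.T ℝ _)] at this
      simpa [chebSeq, add_comm] using this
  · have := plusBlock_chebPhase (a₀ := a₀) hU hρ a b
    simpa [chebSeq] using this

end ChebyshevSequences

/-! ### Reduction of traces to sums over eigenvalues. -/

section Spectrum

variable {S : Type*} [Fintype S] [DecidableEq S]

lemma isHermitian_aeval {ρ : Matrix S S ℂ} (hρ : ρ.IsHermitian) (p : ℝ[X]) :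
    (Polynomial.aeval ρ p).IsHermitian := by
  induction p using Polynomial.induction_on' with
  | add p q hp hq =>
    rw [map_add]
    exact hp.add hq
  | monomial n r =>
    rw [Polynomial.aeval_monomial, ← Algebra.smul_def, Matrix.IsHermitian,
      Matrix.conjTranspose_smul, Matrix.conjTranspose_pow, hρ.eq, star_trivial]

lemma aeval_mul_X_mul_self (ρ : Matrix S S ℂ) (p : ℝ[X]) :
    Polynomial.aeval ρ (p * Polynomial.X * p) =
      Polynomial.aeval ρ p * ρ * Polynomial.aeval ρ p := by
  simp only [map_mul, Polynomial.aeval_X]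

/-- `lam` lists the eigenvalues of the density matrix `ρ`. -/
structure IsSpectrum (ρ : Matrix S S ℂ) (lam : S → ℝ) : Prop where
  isHermitian : ρ.IsHermitian
  nonneg : ∀ i, 0 ≤ lam i
  sum_eq_one : ∑ i, lam i = 1
  trace_aeval : ∀ p : ℝ[X], (Polynomial.aeval ρ p).trace = ((∑ i, p.eval (lam i) : ℝ) : ℂ)

lemma IsSpectrum.le_one {ρ : Matrix S S ℂ} {lam : S → ℝ} (h : IsSpectrum ρ lam) (i : S) :
    lam i ≤ 1 := by
  rw [← h.sum_eq_one]
  exact Finset.single_le_sum (fun j _ => h.nonneg j) (Finset.mem_univ i)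

lemma trace_pow_eq_sum_eigenvalues {ρ : Matrix S S ℂ} (hρ : ρ.IsHermitian) (n : ℕ) :
    (ρ ^ n).trace = ∑ i, (hρ.eigenvalues i : ℂ) ^ n := by
  conv_lhs => rw [hρ.spectral_theorem]
  rw [← map_pow, Matrix.diagonal_pow, Unitary.conjStarAlgAut_apply, Matrix.trace_mul_cycle,
    Unitary.coe_star_mul_self, Matrix.one_mul, Matrix.trace_diagonal]
  rfl

lemma IsDensityMatrix.exists_isSpectrum {ρ : Matrix S S ℂ} (h : IsDensityMatrix ρ) :
    ∃ lam, IsSpectrum ρ lam := by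
  have hH := h.1.isHermitian
  refine ⟨hH.eigenvalues, hH, fun i => h.1.eigenvalues_nonneg i, ?_, fun p => ?_⟩
  · have := trace_pow_eq_sum_eigenvalues hH 1
    simp only [pow_one, h.2] at this
    exact_mod_cast this.symm
  · induction p using Polynomial.induction_on' with
    | add p q hp hq =>
      rw [map_add, Matrix.trace_add, hp, hq, ← Complex.ofReal_add, ← Finset.sum_add_distrib]
      simp only [Polynomial.eval_add]
    | monomial n r =>
      rw [Polynomial.aeval_monomial, ← Algebra.smul_def, Matrix.trace_smul,
        trace_pow_eq_sum_eigenvalues hH]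
      simp [Polynomial.eval_monomial, Finset.mul_sum]

end Spectrum

/-! ### The cyclic shift and the generalized swap test. -/

section CyclicShift

variable {S : Type*} [Fintype S] [DecidableEq S]

/-- Summing over the intermediate indices of a path multiplies the matrices along it. The vector `v`
stands for the factor that later closes the path into a cycle. The order of the factors does not
matter, since polynomials in `ρ` commute. -/
lemma sum_path_aeval (ρ : Matrix S S ℂ) {n : ℕ} (g : Fin n → ℝ[X]) (x : S) (v : S → ℂ) :
    ∑ f : Fin n → S, (∏ j, Polynomial.aeval ρ (g j) (f j)
        ((Fin.cons x f : Fin (n + 1) → S) j.castSucc)) *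
          v ((Fin.cons x f : Fin (n + 1) → S) (Fin.last n)) =
      ∑ y, v y * Polynomial.aeval ρ (∏ j, g j) y x := by
  induction n generalizing x with
  | zero => simp [Matrix.one_apply]
  | succ n ih =>
    rw [← (Fin.consEquiv fun _ => S).sum_comp, Fintype.sum_prod_type]
    have : ∀ z : S, ∑ f : Fin n → S,
        (∏ j, Polynomial.aeval ρ (g j) ((Fin.cons z f : Fin (n + 1) → S) j)
          ((Fin.cons x (Fin.cons z f : Fin (n + 1) → S) : Fin (n + 2) → S) j.castSucc)) *
            v ((Fin.cons x (Fin.cons z f : Fin (n + 1) → S) : Fin (n + 2) → S)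
              (Fin.last (n + 1))) =
        Polynomial.aeval ρ (g 0) z x *
          ∑ y, v y * Polynomial.aeval ρ (∏ j : Fin n, g j.succ) y z := by
      intro z
      rw [← ih (fun j => g j.succ) z, Finset.mul_sum]
      refine Finset.sum_congr rfl fun f _ => ?_
      rw [Fin.prod_univ_succ, ← mul_assoc]
      rfl
    refine (Finset.sum_congr rfl fun z _ => this z).trans ?_
    simp only [Finset.mul_sum]
    rw [Finset.sum_comm]
    refine Finset.sum_congr rfl fun y _ => ?_
    rw [Fin.prod_univ_succ, mul_comm (g 0), map_mul, Matrix.mul_apply, Finset.mul_sum]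
    refine Finset.sum_congr rfl fun z _ => ?_
    ring

lemma trace_cyclicShift_mul_tensorProd (ρ : Matrix S S ℂ) {k : ℕ} (hk : 0 < k)
    (g : Fin k → ℝ[X]) :
    (cyclicShift S k * tensorProd fun j => Polynomial.aeval ρ (g j)).trace =
      (Polynomial.aeval ρ (∏ j, g j)).trace := by
  obtain ⟨m, rfl⟩ : ∃ m, k = m + 1 := ⟨k - 1, by omega⟩
  have h1 : (cyclicShift S (m + 1) * tensorProd fun j => Polynomial.aeval ρ (g j)).trace =
      ∑ f : Fin (m + 1) → S,
        ∏ j, Polynomial.aeval ρ (g j) (f (finRotate (m + 1) j)) (f j) := by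
    rw [Matrix.trace]
    refine Finset.sum_congr rfl fun f _ => ?_
    rw [Matrix.diag_apply, Matrix.mul_apply,
      Finset.sum_eq_single (fun i => f (finRotate (m + 1) i))]
    · simp [cyclicShift, tensorProd]
    · intro h _ hne
      rw [cyclicShift, Matrix.of_apply, if_neg, zero_mul]
      intro hh
      exact hne (funext fun i => (hh i).symm)
    · simp
  rw [h1, ← (Fin.consEquiv fun _ => S).sum_comp, Fintype.sum_prod_type, Fin.prod_univ_castSucc,
    mul_comm, map_mul, Matrix.trace]
  refine Finset.sum_congr rfl fun x _ => ?_
  rw [Matrix.diag_apply, Matrix.mul_apply,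
    ← sum_path_aeval ρ (fun j : Fin m => g j.castSucc) x
      (fun y => Polynomial.aeval ρ (g (Fin.last m)) x y)]
  refine Finset.sum_congr rfl fun f _ => ?_
  rw [Fin.prod_univ_castSucc]
  simp only [Fin.consEquiv_apply, finRotate_last]
  congr 1
  refine Finset.prod_congr rfl fun j _ => ?_
  rw [show finRotate (m + 1) j.castSucc = j.succ by simp]
  simp

lemma trace_tensorProd {S : Type*} [Fintype S] {k : ℕ} (σ : Fin k → Matrix S S ℂ) :
    (tensorProd σ).trace = ∏ j, (σ j).trace := by
  simp only [Matrix.trace, Matrix.diag_apply, tensorProd, Matrix.of_apply]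
  rw [Finset.prod_univ_sum, Fintype.piFinset_univ]

lemma isHermitian_tensorProd {S : Type*} {k : ℕ} {σ : Fin k → Matrix S S ℂ} (h : ∀ j, (σ j).IsHermitian) :
    (tensorProd σ).IsHermitian := by
  ext f g
  simp only [Matrix.conjTranspose_apply, tensorProd, Matrix.of_apply, star_prod]
  exact Finset.prod_congr rfl fun j _ => (h j).apply _ _

lemma conjTranspose_cyclicShift_mul_self (k : ℕ) :
    (cyclicShift S k)ᴴ * cyclicShift S k = 1 := by
  have h : cyclicShift S k = (1 : Matrix (Fin k → S) (Fin k → S) ℂ).submatrix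
      ((finRotate k).symm.arrowCongr (Equiv.refl S)) (Equiv.refl _) := by
    ext f g
    simp only [cyclicShift, Matrix.of_apply, Matrix.submatrix_apply, Matrix.one_apply,
      funext_iff]
    simp
  rw [h, Matrix.conjTranspose_submatrix, Matrix.submatrix_mul_equiv]
  simp

/-- Since the shift is unitary, both diagonal terms contribute `tr τ`. Hermiticity of `τ` makes the
cross terms complex conjugates of each other. -/
lemma bornProb_hadamardKraus_cyclicShift {k : ℕ} {τ : Matrix (Fin k → S) (Fin k → S) ℂ}
    (hτ : τ.IsHermitian) (plus : Bool) :
    bornProb (hadamardKraus (cyclicShift S k) plus) τ =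
      (τ.trace.re + (if plus then 1 else -1) * (cyclicShift S k * τ).trace.re) / 2 := by
  set c := cyclicShift S k with hc
  have hcc : cᴴ * c = 1 := conjTranspose_cyclicShift_mul_self k
  have h1 : (τ * cᴴ).trace = star (c * τ).trace := by
    rw [← Matrix.trace_conjTranspose, Matrix.conjTranspose_mul, hτ.eq]
  have h2 : (c * τ * cᴴ).trace = τ.trace := by
    rw [Matrix.trace_mul_cycle, hcc, Matrix.one_mul]
  have h3 : ∀ s : ℂ, star s = s → s * s = 1 →
      (((1 / 2 : ℂ) • (1 + s • c)) * τ * ((1 / 2 : ℂ) • (1 + s • c))ᴴ).trace =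
        (1 / 4) * (2 * τ.trace + s * ((c * τ).trace + star (c * τ).trace)) := by
    intro s hs hss
    have : ((1 / 2 : ℂ) • (1 + s • c))ᴴ = (1 / 2 : ℂ) • (1 + s • cᴴ) := by
      rw [Matrix.conjTranspose_smul, Matrix.conjTranspose_add, Matrix.conjTranspose_smul, hs]
      simp
    rw [this]
    simp only [Matrix.smul_mul, Matrix.mul_smul, Matrix.add_mul, Matrix.mul_add, Matrix.one_mul,
      Matrix.mul_one, Matrix.trace_smul, Matrix.trace_add, smul_eq_mul, h1, h2]
    linear_combination (1 / 4) * τ.trace * hss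
  rw [bornProb, hadamardKraus, h3 _ (by cases plus <;> simp) (by cases plus <;> simp)]
  cases plus <;> simp <;> ring

end CyclicShift

/-! ### Outcome distributions and means of the two kinds of tests. -/

section Tests

lemma SignType.sum_univ {M : Type*} [AddCommMonoid M] (f : SignType → M) :
    ∑ o, f o = f .zero + (f .neg + f .pos) := by
  rw [show (Finset.univ : Finset SignType) = {.zero, .neg, .pos} from rfl,
    Finset.sum_insert (by decide), Finset.sum_pair (by decide)]

variable {A S : Type*} [Fintype A] [DecidableEq A] [Fintype S] [DecidableEq S]

/-- The outcome distribution of the test is a probability distribution with mean `m`. -/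
structure QSPTest.HasMean {k : ℕ} (a₀ : A) (U : Matrix (A × S) (A × S) ℂ) (ρ : Matrix S S ℂ)
    (T : QSPTest k) (m : ℝ) : Prop where
  nonneg : ∀ o, 0 ≤ T.prob a₀ U ρ o
  sum_eq_one : ∑ o, T.prob a₀ U ρ o = 1
  mean : ∑ o, T.prob a₀ U ρ o * (o : ℝ) = m

variable {a₀ : A} {U : Matrix (A × S) (A × S) ℂ} {ρ : Matrix S S ℂ} {k : ℕ}

lemma QSPTest.hasMean_of_passProb {T : QSPTest k} {m : ℝ}
    (h1 : 0 ≤ T.passProb a₀ U ρ true) (h2 : 0 ≤ T.passProb a₀ U ρ false)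
    (h3 : T.passProb a₀ U ρ true + T.passProb a₀ U ρ false ≤ 1)
    (h4 : T.passProb a₀ U ρ true - T.passProb a₀ U ρ false = m) : T.HasMean a₀ U ρ m where
  nonneg o := by
    cases o
    · simp only [QSPTest.prob]
      linarith
    · exact h2
    · exact h1
  sum_eq_one := by
    rw [SignType.sum_univ]
    simp only [QSPTest.prob]
    ring
  mean := by
    rw [SignType.sum_univ, ← h4]
    simp only [QSPTest.prob, SignType.zero_eq_zero, SignType.neg_eq_neg_one,
      SignType.pos_eq_one, SignType.coe_zero, SignType.coe_neg, SignType.coe_one]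
    ring

lemma abs_eval_chebProd_le_one (a b : ℕ) {x : ℝ} (hx : |x| ≤ 1) :
    |(chebProd a b).eval x| ≤ 1 := by
  rw [chebProd, Polynomial.eval_mul, abs_mul]
  exact mul_le_one₀ (Polynomial.Chebyshev.abs_eval_T_real_le_one _ hx) (abs_nonneg _)
    (Polynomial.Chebyshev.abs_eval_T_real_le_one _ hx)

lemma IsSpectrum.abs_eval_chebProd_le_one {lam : S → ℝ} (h : IsSpectrum ρ lam) (a b : ℕ) (i : S) :
    |(chebProd a b).eval (lam i)| ≤ 1 :=
  _root_.abs_eval_chebProd_le_one a b (by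
    rw [abs_of_nonneg (h.nonneg i)]
    exact h.le_one i)

/-- The control qubit is measured together with the post-selection, so the Kraus operators are `(1 ±
p(ρ))/2`. The difference of their squares is `p(ρ)`, which makes the mean linear in `p`, whereas the
parallel test is quadratic in each thread. -/
lemma IsSpectrum.passProb_hadamard_chebSeq {lam : S → ℝ} (h : IsSpectrum ρ lam)
    (hU : IsBlockEncoding a₀ U ρ) (a b : ℕ) (plus : Bool) :
    (QSPTest.hadamard (chebSeq a b) : QSPTest k).passProb a₀ U ρ plus =
      ∑ i, lam i * ((1 + (if plus then 1 else -1) * (chebProd a b).eval (lam i)) / 2) ^ 2 := by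
  set s : ℝ := if plus then 1 else -1 with hs
  set W := qspUnitary a₀ U (chebSeq a b).phase (chebSeq a b).queries with hW
  have h0 : plusBlock a₀ (hadamardKraus W plus) =
      (1 / 2 : ℂ) • ((1 : Matrix S S ℂ) + (s : ℂ) • plusBlock a₀ W) := by
    ext i j
    have hsc : (if plus then 1 else -1 : ℂ) = s := by
      rw [hs]
      split_ifs <;> simp
    simp only [plusBlock, hadamardKraus, hsc, Matrix.of_apply, Matrix.smul_apply,
      Matrix.add_apply, Matrix.one_apply, Fin.sum_univ_two, smul_eq_mul, Prod.mk.injEq]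
    by_cases hij : i = j <;> simp [hij] <;> ring
  have h1 : plusBlock a₀ (hadamardKraus W plus) = Polynomial.aeval ρ
      (Polynomial.C (1 / 2) * (1 + Polynomial.C s * chebProd a b)) := by
    rw [h0, hW, plusBlock_chebSeq hU h.isHermitian, map_mul, map_add, map_mul, map_one,
      Polynomial.aeval_C, Polynomial.aeval_C, ← Algebra.smul_def, ← Algebra.smul_def]
    ext i j
    simp
    ring
  rw [QSPTest.passProb, ← hW, bornProb, h1, (isHermitian_aeval h.isHermitian _).eq]
  rw [← aeval_mul_X_mul_self, h.trace_aeval, Complex.ofReal_re]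
  refine Finset.sum_congr rfl fun i _ => ?_
  simp only [Polynomial.eval_mul, Polynomial.eval_C, Polynomial.eval_add, Polynomial.eval_one,
    Polynomial.eval_X]
  ring

lemma IsSpectrum.hasMean_hadamard_chebSeq {lam : S → ℝ} (h : IsSpectrum ρ lam)
    (hU : IsBlockEncoding a₀ U ρ) (a b : ℕ) :
    (QSPTest.hadamard (chebSeq a b) : QSPTest k).HasMean a₀ U ρ
      (∑ i, lam i * (chebProd a b).eval (lam i)) := by
  have hp := h.passProb_hadamard_chebSeq (k := k) hU a b
  have nonneg : ∀ plus, 0 ≤ (QSPTest.hadamard (chebSeq a b) : QSPTest k).passProb a₀ U ρ plus :=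
    fun plus => by
      rw [hp]
      exact Finset.sum_nonneg fun i _ => mul_nonneg (h.nonneg i) (sq_nonneg _)
  refine QSPTest.hasMean_of_passProb (nonneg _) (nonneg _) ?_ ?_
  · rw [hp, hp, ← Finset.sum_add_distrib]
    refine le_trans (Finset.sum_le_sum fun i _ => ?_) h.sum_eq_one.le
    have h1 := (sq_le_one_iff_abs_le_one _).mpr (h.abs_eval_chebProd_le_one a b i)
    simp only [if_true, Bool.false_eq_true, if_false]
    nlinarith [h.nonneg i, mul_le_mul_of_nonneg_left h1 (h.nonneg i)]
  · rw [hp, hp, ← Finset.sum_sub_distrib]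
    refine Finset.sum_congr rfl fun i _ => ?_
    simp only [if_true, Bool.false_eq_true, if_false]
    ring

/-- One factor is kept at `i`, and each other factor is enlarged to its full sum. In the parallel
test this gives a nonnegative probability for the outcome `-`. -/
lemma sum_prod_le_prod_sum {ι : Type*} [Fintype ι] (hk : 0 < k) {f : Fin k → ι → ℝ}
    (hf : ∀ j i, 0 ≤ f j i) : ∑ i, ∏ j, f j i ≤ ∏ j, ∑ i, f j i := by
  obtain ⟨m, rfl⟩ : ∃ m, k = m + 1 := ⟨k - 1, by omega⟩
  rw [Fin.prod_univ_succ, Finset.sum_mul]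
  refine Finset.sum_le_sum fun i _ => ?_
  rw [Fin.prod_univ_succ]
  refine mul_le_mul_of_nonneg_left ?_ (hf _ _)
  exact Finset.prod_le_prod (fun j _ => hf _ _)
    fun j _ => Finset.single_le_sum (fun i _ => hf _ i) (Finset.mem_univ i)

lemma IsSpectrum.passProb_parallel_chebSeq {lam : S → ℝ} (h : IsSpectrum ρ lam)
    (hU : IsBlockEncoding a₀ U ρ) (hk : 0 < k) (a b : Fin k → ℕ) (plus : Bool) :
    (QSPTest.parallel fun j => chebSeq (a j) (b j)).passProb a₀ U ρ plus =
      (∏ j, ∑ i, lam i * (chebProd (a j) (b j)).eval (lam i) ^ 2 +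
        (if plus then 1 else -1) *
          ∑ i, lam i ^ k * ∏ j, (chebProd (a j) (b j)).eval (lam i) ^ 2) / 2 := by
  have h1 : ∀ j, plusBlock a₀ (qspUnitary a₀ U (chebSeq (a j) (b j)).phase
      (chebSeq (a j) (b j)).queries) * ρ * (plusBlock a₀ (qspUnitary a₀ U
        (chebSeq (a j) (b j)).phase (chebSeq (a j) (b j)).queries))ᴴ =
      Polynomial.aeval ρ (chebProd (a j) (b j) * Polynomial.X * chebProd (a j) (b j)) := by
    intro j
    rw [plusBlock_chebSeq hU h.isHermitian, (isHermitian_aeval h.isHermitian _).eq,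
      aeval_mul_X_mul_self]
  rw [QSPTest.passProb]
  simp only [h1]
  rw [bornProb_hadamardKraus_cyclicShift
      (isHermitian_tensorProd fun j => isHermitian_aeval h.isHermitian _),
    trace_tensorProd, trace_cyclicShift_mul_tensorProd ρ hk]
  simp only [h.trace_aeval]
  rw [← Complex.ofReal_prod, Complex.ofReal_re, Complex.ofReal_re]
  congr 3
  · refine funext fun j => Finset.sum_congr rfl fun i _ => ?_
    simp only [Polynomial.eval_mul, Polynomial.eval_X]
    ring
  · refine Finset.sum_congr rfl fun i _ => ?_
    have : lam i ^ k = ∏ _j : Fin k, lam i := by simp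
    rw [Polynomial.eval_prod, this, ← Finset.prod_mul_distrib]
    refine Finset.prod_congr rfl fun j _ => ?_
    simp only [Polynomial.eval_mul, Polynomial.eval_X]
    ring

lemma IsSpectrum.hasMean_parallel_chebSeq {lam : S → ℝ} (h : IsSpectrum ρ lam)
    (hU : IsBlockEncoding a₀ U ρ) (hk : 0 < k) (a b : Fin k → ℕ) :
    (QSPTest.parallel fun j => chebSeq (a j) (b j)).HasMean a₀ U ρ
      (∑ i, lam i ^ k * ∏ j, (chebProd (a j) (b j)).eval (lam i) ^ 2) := by
  have hp := h.passProb_parallel_chebSeq hU hk a b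
  have h0 : 0 ≤ ∑ i, lam i ^ k * ∏ j, (chebProd (a j) (b j)).eval (lam i) ^ 2 :=
    Finset.sum_nonneg fun i _ => mul_nonneg (pow_nonneg (h.nonneg i) k)
      (Finset.prod_nonneg fun j _ => sq_nonneg _)
  have h1 : ∑ i, lam i ^ k * ∏ j, (chebProd (a j) (b j)).eval (lam i) ^ 2 ≤
      ∏ j, ∑ i, lam i * (chebProd (a j) (b j)).eval (lam i) ^ 2 := by
    refine le_trans (le_of_eq ?_) (sum_prod_le_prod_sum hk
      (f := fun j i => lam i * (chebProd (a j) (b j)).eval (lam i) ^ 2)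
      fun j i => mul_nonneg (h.nonneg i) (sq_nonneg _))
    refine Finset.sum_congr rfl fun i _ => ?_
    rw [Finset.prod_mul_distrib]
    simp
  have h2 : ∏ j, ∑ i, lam i * (chebProd (a j) (b j)).eval (lam i) ^ 2 ≤ 1 := by
    refine Finset.prod_le_one (fun j _ => Finset.sum_nonneg fun i _ =>
      mul_nonneg (h.nonneg i) (sq_nonneg _)) fun j _ => ?_
    rw [← h.sum_eq_one]
    exact Finset.sum_le_sum fun i _ => mul_le_of_le_one_right (h.nonneg i)
      ((sq_le_one_iff_abs_le_one _).mpr (h.abs_eval_chebProd_le_one _ _ i))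
  refine QSPTest.hasMean_of_passProb ?_ ?_ ?_ ?_ <;> simp only [hp] <;> simp <;> linarith

end Tests

/-! ### Discrete orthogonality and bounds for Chebyshev coefficients. -/

section ChebyshevExpansion

open Polynomial.Chebyshev (T)

/-- The Chebyshev angles, whose cosines are the zeros of `T_N`. -/
noncomputable def chebAngle (N i : ℕ) : ℝ := (2 * i + 1) * (Real.pi / (2 * N))

/-- Multiplication by `2 sin h`, with `h = mπ/(2N)`, makes the sum telescope to `sin(mπ) = 0`. The
range of `m` ensures `sin h ≠ 0`. -/
lemma sum_cos_mul_chebAngle {N m : ℕ} (hm : 0 < m) (hmN : m < 2 * N) :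
    ∑ i ∈ Finset.range N, Real.cos (m * chebAngle N i) = 0 := by
  have hN : (0 : ℝ) < N := by
    have : 0 < N := by omega
    exact_mod_cast this
  have hm' : (0 : ℝ) < m := by exact_mod_cast hm
  have hmN' : (m : ℝ) < 2 * N := by exact_mod_cast hmN
  set h : ℝ := m * (Real.pi / (2 * N)) with hh
  have hpos : 0 < h := by positivity
  have hlt : h < Real.pi := by
    rw [hh, ← mul_div_assoc, div_lt_iff₀ (by positivity), mul_comm]
    exact mul_lt_mul_of_pos_left hmN' Real.pi_pos
  have hs : Real.sin h ≠ 0 := (Real.sin_pos_of_pos_of_lt_pi hpos hlt).ne'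
  have key : ∀ i : ℕ, 2 * Real.sin h * Real.cos (m * chebAngle N i) =
      Real.sin (2 * ((i + 1 : ℕ) : ℝ) * h) - Real.sin (2 * (i : ℝ) * h) := by
    intro i
    have e1 : (2 * ((i + 1 : ℕ) : ℝ) * h) = m * chebAngle N i + h := by
      rw [hh, chebAngle]
      push_cast
      ring
    have e2 : (2 * (i : ℝ) * h) = m * chebAngle N i - h := by
      rw [hh, chebAngle]
      ring
    rw [e1, e2, Real.sin_add, Real.sin_sub]
    ring
  have hsum : 2 * Real.sin h * ∑ i ∈ Finset.range N, Real.cos (m * chebAngle N i) = 0 := by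
    rw [Finset.mul_sum, Finset.sum_congr rfl fun i _ => key i,
      Finset.sum_range_sub fun i : ℕ => Real.sin (2 * (i : ℝ) * h)]
    have e3 : 2 * (N : ℝ) * h = m * Real.pi := by
      rw [hh]
      field_simp
    rw [e3, Real.sin_nat_mul_pi]
    simp
  exact (mul_eq_zero.mp hsum).resolve_left (mul_ne_zero two_ne_zero hs)

lemma eval_T_mul_eval_T_cos (s t : ℕ) (θ : ℝ) :
    (T ℝ s).eval (Real.cos θ) * (T ℝ t).eval (Real.cos θ) =
      (Real.cos ((s + t : ℕ) * θ) + Real.cos ((s - t) * θ)) / 2 := by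
  rw [Polynomial.Chebyshev.T_real_cos, Polynomial.Chebyshev.T_real_cos]
  push_cast
  rw [add_mul, sub_mul, Real.cos_add, Real.cos_sub]
  ring

lemma sum_eval_T_mul_eval_T_of_lt {N s t : ℕ} (hts : t < s) (hs : s < N) :
    ∑ i ∈ Finset.range N, (T ℝ s).eval (Real.cos (chebAngle N i)) *
      (T ℝ t).eval (Real.cos (chebAngle N i)) = 0 := by
  simp only [eval_T_mul_eval_T_cos]
  rw [← Finset.sum_div, Finset.sum_add_distrib, ← Nat.cast_sub hts.le,
    sum_cos_mul_chebAngle (by omega) (by omega), sum_cos_mul_chebAngle (by omega) (by omega)]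
  simp

lemma sum_eval_T_mul_eval_T_of_ne {N s t : ℕ} (hne : s ≠ t) (hs : s < N) (ht : t < N) :
    ∑ i ∈ Finset.range N, (T ℝ s).eval (Real.cos (chebAngle N i)) *
      (T ℝ t).eval (Real.cos (chebAngle N i)) = 0 := by
  rcases lt_or_gt_of_ne hne with h | h
  · simp only [mul_comm ((T ℝ (s : ℤ)).eval _)]
    exact sum_eval_T_mul_eval_T_of_lt h ht
  · exact sum_eval_T_mul_eval_T_of_lt h hs

/-- The sum is `N` for `s = 0` and `N/2` otherwise. The lower bound treats both cases alike. -/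
lemma le_sum_eval_T_mul_self {N s : ℕ} (hs : s < N) :
    (N : ℝ) / 2 ≤ ∑ i ∈ Finset.range N, (T ℝ s).eval (Real.cos (chebAngle N i)) *
      (T ℝ s).eval (Real.cos (chebAngle N i)) := by
  simp only [eval_T_mul_eval_T_cos]
  rw [← Finset.sum_div, Finset.sum_add_distrib]
  rcases Nat.eq_zero_or_pos s with rfl | h
  · simp
  · rw [sum_cos_mul_chebAngle (by omega) (by omega)]
    simp

lemma exists_eq_sum_T (K : ℕ) (f : ℝ[X]) (hf : f.degree < K) :
    ∃ c : ℕ → ℝ, f = ∑ t ∈ Finset.range K, Polynomial.C (c t) * T ℝ t := by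
  induction K generalizing f with
  | zero =>
    refine ⟨0, ?_⟩
    have : f = 0 := by simpa using hf
    simp [this]
  | succ K ih =>
    set r : ℝ := f.coeff K / (T ℝ K).leadingCoeff with hr
    have hlead : (T ℝ K).coeff K = (T ℝ K).leadingCoeff := by
      rw [Polynomial.leadingCoeff, Polynomial.Chebyshev.natDegree_T, Int.natAbs_natCast]
    have hne : (T ℝ K).leadingCoeff ≠ 0 :=
      Polynomial.leadingCoeff_ne_zero.mpr (Polynomial.Chebyshev.T_ne_zero ℝ _)
    obtain ⟨c, hc⟩ := ih (f - Polynomial.C r * T ℝ K) (by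
      rw [Polynomial.degree_lt_iff_coeff_zero] at hf ⊢
      intro m hm
      rw [Polynomial.coeff_sub, Polynomial.coeff_C_mul]
      rcases hm.eq_or_lt with rfl | hm
      · rw [hlead, hr, div_mul_cancel₀ _ hne, sub_self]
      · rw [hf m hm, Polynomial.coeff_eq_zero_of_natDegree_lt (p := T ℝ K), mul_zero, sub_zero]
        simpa using hm)
    refine ⟨Function.update c K r, ?_⟩
    rw [Finset.sum_range_succ, Function.update_self, ← sub_eq_iff_eq_add, hc]
    refine Finset.sum_congr rfl fun t ht => ?_
    rw [Function.update_of_ne (Finset.mem_range.mp ht).ne]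

/-- Chebyshev expansion, with a bound for the coefficients from the values at the zeros of
`T_N`. -/
lemma exists_eq_sum_T_sq_le {K N : ℕ} (hKN : K ≤ N) (f : ℝ[X]) (hf : f.degree < K) :
    ∃ c : ℕ → ℝ, f = ∑ t ∈ Finset.range K, Polynomial.C (c t) * T ℝ t ∧
      N / 2 * ∑ t ∈ Finset.range K, c t ^ 2 ≤
        ∑ i ∈ Finset.range N, f.eval (Real.cos (chebAngle N i)) ^ 2 := by
  obtain ⟨c, hc⟩ := exists_eq_sum_T K f hf
  refine ⟨c, hc, ?_⟩
  have h1 : ∑ i ∈ Finset.range N, f.eval (Real.cos (chebAngle N i)) ^ 2 =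
      ∑ s ∈ Finset.range K, ∑ t ∈ Finset.range K, c s * c t *
        ∑ i ∈ Finset.range N, (T ℝ s).eval (Real.cos (chebAngle N i)) *
          (T ℝ t).eval (Real.cos (chebAngle N i)) := by
    simp only [Finset.mul_sum]
    rw [Finset.sum_congr rfl fun s _ => Finset.sum_comm, Finset.sum_comm]
    refine Finset.sum_congr rfl fun i _ => ?_
    rw [hc, Polynomial.eval_finsetSum, sq, Finset.sum_mul_sum]
    refine Finset.sum_congr rfl fun s _ => Finset.sum_congr rfl fun t _ => ?_
    simp only [Polynomial.eval_mul, Polynomial.eval_C]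
    ring
  rw [h1, Finset.mul_sum]
  refine Finset.sum_le_sum fun s hs => ?_
  have hsN : s < N := (Finset.mem_range.mp hs).trans_le hKN
  rw [Finset.sum_eq_single_of_mem s hs]
  · nlinarith [mul_le_mul_of_nonneg_left (le_sum_eval_T_mul_self hsN) (sq_nonneg (c s))]
  · intro t ht hts
    rw [sum_eval_T_mul_eval_T_of_ne hts.symm hsN ((Finset.mem_range.mp ht).trans_le hKN),
      mul_zero]

lemma bddAbove_abs_eval (f : ℝ[X]) :
    BddAbove ((fun x : ℝ => |f.eval x|) '' Set.Icc (-1) 1) :=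
  (isCompact_Icc.image (by fun_prop)).bddAbove

lemma abs_eval_le_unitNorm (f : ℝ[X]) {x : ℝ} (hx : x ∈ Set.Icc (-1 : ℝ) 1) :
    |f.eval x| ≤ unitNorm f :=
  le_csSup (bddAbove_abs_eval f) ⟨x, hx, rfl⟩

lemma unitNorm_nonneg (f : ℝ[X]) : 0 ≤ unitNorm f :=
  (abs_nonneg _).trans (abs_eval_le_unitNorm f (x := 0) (by constructor <;> norm_num))

lemma unitNorm_pos {f : ℝ[X]} (hf : f ≠ 0) : 0 < unitNorm f := by
  refine (unitNorm_nonneg f).lt_of_ne fun h => hf ?_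
  refine Polynomial.eq_zero_of_infinite_isRoot f
    ((Set.Icc_infinite (show (-1 : ℝ) < 1 by norm_num)).mono fun x hx => ?_)
  have := abs_eval_le_unitNorm f hx
  rw [← h] at this
  exact abs_nonpos_iff.mp this

/-- Sampling at the `K` zeros of `T_K` gives `∑ c_t² ≤ 2‖f‖²`, hence even `|c_t| ≤ √2 ‖f‖`. -/
lemma exists_eq_sum_T_abs_le (K : ℕ) (f : ℝ[X]) (hf : f.degree < K) :
    ∃ c : ℕ → ℝ, f = ∑ t ∈ Finset.range K, Polynomial.C (c t) * T ℝ t ∧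
      ∀ t < K, |c t| ≤ 2 * unitNorm f := by
  obtain ⟨c, hc, hle⟩ := exists_eq_sum_T_sq_le le_rfl f hf
  refine ⟨c, hc, fun t ht => ?_⟩
  have hK : (0 : ℝ) < K := by exact_mod_cast (Nat.zero_le t).trans_lt ht
  have h1 : ∑ i ∈ Finset.range K, f.eval (Real.cos (chebAngle K i)) ^ 2 ≤
      K * unitNorm f ^ 2 := by
    refine (Finset.sum_le_card_nsmul _ _ (unitNorm f ^ 2) fun i _ => ?_).trans (by simp)
    rw [← sq_abs]
    exact pow_le_pow_left₀ (abs_nonneg _) (abs_eval_le_unitNorm f (Real.cos_mem_Icc _)) 2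
  have h2 : c t ^ 2 ≤ ∑ t ∈ Finset.range K, c t ^ 2 :=
    Finset.single_le_sum (fun t _ => sq_nonneg (c t)) (Finset.mem_range.mpr ht)
  have h3 : K * (c t ^ 2 / 2) ≤ K * unitNorm f ^ 2 := by nlinarith
  have h4 := le_of_mul_le_mul_left h3 hK
  refine abs_le_of_sq_le_sq ?_ (by linarith [unitNorm_nonneg f])
  nlinarith [sq_nonneg (unitNorm f)]

end ChebyshevExpansion

/-! ### Chebyshev coefficients of the low part. -/

section LowPart

open Polynomial.Chebyshev (T)

lemma sum_one_div_odd_sq_le (k : ℕ) :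
    ∑ j ∈ Finset.range k, 1 / (2 * (j : ℝ) + 1) ^ 2 ≤ 2 := by
  -- The stronger bound `2 - 1/(k+1)` makes the induction work, by comparison with a telescoping
  -- series.
  have key : ∀ k : ℕ, ∑ j ∈ Finset.range (k + 1), 1 / (2 * (j : ℝ) + 1) ^ 2 ≤
      2 - 1 / ((k : ℝ) + 1) := by
    intro k
    induction k with
    | zero => norm_num
    | succ k ih =>
      rw [Finset.sum_range_succ]
      have hk : (0 : ℝ) ≤ k := Nat.cast_nonneg k
      have h1 : 1 / (2 * ((k : ℝ) + 1) + 1) ^ 2 ≤ 1 / (((k : ℝ) + 1) * (k + 1 + 1)) :=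
        one_div_le_one_div_of_le (by positivity) (by nlinarith)
      have h2 : 1 / (((k : ℝ) + 1) * (k + 1 + 1)) = 1 / ((k : ℝ) + 1) - 1 / ((k : ℝ) + 1 + 1) := by
        field_simp
        ring
      push_cast
      linarith
  rcases k with _ | k
  · simp
  · have : 0 ≤ 1 / ((k : ℝ) + 1) := by positivity
    linarith [key k]

/-- This is Jordan's inequality `|sin y| ≥ 2|y|/π` at `y = π/2 - θ`. -/
lemma abs_cos_chebAngle_ge {k : ℕ} (i : ℕ) (hi : i < 2 * k) :
    |2 * (k : ℝ) - 2 * i - 1| / (2 * k) ≤ |Real.cos (chebAngle (2 * k) i)| := by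
  have hk : (0 : ℝ) < k := by
    have : 0 < k := by omega
    exact_mod_cast this
  have hi' : (i : ℝ) + 1 ≤ 2 * k := by exact_mod_cast hi
  have hi0 : (0 : ℝ) ≤ i := Nat.cast_nonneg i
  rw [← Real.sin_pi_div_two_sub]
  have e : Real.pi / 2 - chebAngle (2 * k) i = Real.pi / 2 * ((2 * k - 2 * i - 1) / (2 * k)) := by
    rw [chebAngle]
    push_cast
    field_simp
    ring
  have hle : |(2 * (k : ℝ) - 2 * i - 1) / (2 * k)| ≤ 1 := by
    rw [abs_div, abs_of_pos (by positivity : (0 : ℝ) < 2 * k), div_le_one (by positivity),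
      abs_le]
    constructor <;> linarith
  have := Real.mul_abs_le_abs_sin (x := Real.pi / 2 * ((2 * k - 2 * i - 1) / (2 * k))) (by
    rw [abs_mul, abs_of_pos (by positivity : 0 < Real.pi / 2)]
    nlinarith [Real.pi_pos])
  rw [e]
  refine le_trans (le_of_eq ?_) this
  rw [abs_mul, abs_of_pos (by positivity : 0 < Real.pi / 2), abs_div,
    abs_of_pos (by positivity : (0 : ℝ) < 2 * k)]
  field_simp

lemma sum_one_div_cos_chebAngle_sq_le (k : ℕ) :
    ∑ i ∈ Finset.range (2 * k), 1 / Real.cos (chebAngle (2 * k) i) ^ 2 ≤ 16 * (k : ℝ) ^ 2 := by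
  rcases Nat.eq_zero_or_pos k with rfl | hkpos
  · simp
  have hk : (0 : ℝ) < k := by exact_mod_cast hkpos
  have h1 : ∀ i ∈ Finset.range (2 * k), 1 / Real.cos (chebAngle (2 * k) i) ^ 2 ≤
      4 * (k : ℝ) ^ 2 * (1 / (2 * (k : ℝ) - 2 * i - 1) ^ 2) := by
    intro i hi
    have hne : (2 * (k : ℝ) - 2 * i - 1) ≠ 0 := by
      have : (2 * (k : ℤ) - 2 * i - 1) ≠ 0 := by omega
      exact_mod_cast this
    have hpos : 0 < |2 * (k : ℝ) - 2 * i - 1| / (2 * k) := by positivity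
    have h2 := pow_le_pow_left₀ hpos.le (abs_cos_chebAngle_ge i (Finset.mem_range.mp hi)) 2
    rw [sq_abs] at h2
    refine (one_div_le_one_div_of_le (by positivity) h2).trans (le_of_eq ?_)
    rw [div_pow, sq_abs]
    field_simp
    ring
  refine (Finset.sum_le_sum h1).trans ?_
  -- The nodes are symmetric about zero, so each half gives the sum over odd squares, at most `2`.
  -- The total is `4k² (2 + 2)`.
  rw [← Finset.mul_sum, two_mul k, Finset.sum_range_add, ← Finset.sum_range_reflect]
  have h3 : ∀ j ∈ Finset.range k, 1 / (2 * (k : ℝ) - 2 * (k - 1 - j : ℕ) - 1) ^ 2 =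
      1 / (2 * (j : ℝ) + 1) ^ 2 := by
    intro j hj
    have : j < k := Finset.mem_range.mp hj
    rw [Nat.cast_sub (by omega), Nat.cast_sub (by omega)]
    congr 2
    push_cast
    ring
  have h4 : ∀ j ∈ Finset.range k, 1 / (2 * (k : ℝ) - 2 * (k + j : ℕ) - 1) ^ 2 =
      1 / (2 * (j : ℝ) + 1) ^ 2 := by
    intro j _
    congr 1
    push_cast
    ring
  rw [Finset.sum_congr rfl h3, Finset.sum_congr rfl h4]
  nlinarith [sum_one_div_odd_sq_le k, mul_le_mul_of_nonneg_left (sum_one_div_odd_sq_le k)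
    (sq_nonneg (k : ℝ))]

lemma coeff_lowPart (k : ℕ) (P : ℝ[X]) (n : ℕ) :
    (lowPart k P).coeff n = if n < k then P.coeff n else 0 := by
  simp [lowPart, Polynomial.finsetSum_coeff, Polynomial.coeff_monomial]

/-- After splitting off the constant term, `P_{<k}` is `x` times a Chebyshev expansion with
small coefficients. -/
lemma exists_lowPart_expansion {k : ℕ} (hk : 0 < k) (P : ℝ[X]) :
    ∃ c : ℕ → ℝ, (∀ x : ℝ, (lowPart k P).eval x = P.coeff 0 +
        x * ∑ t ∈ Finset.range k, c t * (T ℝ t).eval x) ∧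
      ∑ t ∈ Finset.range k, c t ^ 2 ≤ 64 * (k * unitNorm (lowPart k P) ^ 2) := by
  have hk' : (0 : ℝ) < k := by exact_mod_cast hk
  set L := lowPart k P with hL
  have h0 : L.coeff 0 = P.coeff 0 := by rw [hL, coeff_lowPart, if_pos hk]
  have hdeg : L.divX.degree < k := by
    rw [Polynomial.degree_lt_iff_coeff_zero]
    intro m hm
    rw [Polynomial.coeff_divX, hL, coeff_lowPart, if_neg (by omega)]
  -- The number of nodes is even, so no node is zero and division by `x` is possible at each of
  -- them.
  obtain ⟨c, hc, hle⟩ := exists_eq_sum_T_sq_le (N := 2 * k) (by omega) L.divX hdeg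
  have heval : ∀ x, L.eval x = P.coeff 0 + x * L.divX.eval x := by
    intro x
    conv_lhs => rw [← Polynomial.divX_mul_X_add L]
    simp [h0]
    ring
  refine ⟨c, fun x => ?_, ?_⟩
  · rw [heval, hc, Polynomial.eval_finsetSum]
    simp
  · have h1 : ∀ i ∈ Finset.range (2 * k), L.divX.eval (Real.cos (chebAngle (2 * k) i)) ^ 2 ≤
        4 * unitNorm L ^ 2 * (1 / Real.cos (chebAngle (2 * k) i) ^ 2) := by
      intro i hi
      set x := Real.cos (chebAngle (2 * k) i) with hx
      have hxpos : 0 < |x| := by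
        refine lt_of_lt_of_le ?_ (abs_cos_chebAngle_ge i (Finset.mem_range.mp hi))
        have hne : (2 * (k : ℝ) - 2 * i - 1) ≠ 0 := by
          have : (2 * (k : ℤ) - 2 * i - 1) ≠ 0 := by omega
          exact_mod_cast this
        positivity
      have hb : |x * L.divX.eval x| ≤ 2 * unitNorm L := by
        have e : x * L.divX.eval x = L.eval x - L.eval 0 := by
          rw [heval x, heval 0]
          ring
        rw [e]
        have h1 := abs_eval_le_unitNorm L (Real.cos_mem_Icc (chebAngle (2 * k) i))
        have h2 := abs_eval_le_unitNorm L (x := 0) (by constructor <;> norm_num)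
        exact (abs_sub _ _).trans (by linarith)
      have hsq := pow_le_pow_left₀ (abs_nonneg _) hb 2
      rw [sq_abs, mul_pow] at hsq
      have hx2 : 0 < x ^ 2 := by
        rw [← sq_abs]
        positivity
      rw [mul_one_div, le_div_iff₀ hx2]
      nlinarith
    have h2 := hle.trans (Finset.sum_le_sum h1)
    rw [← Finset.mul_sum] at h2
    have h3 := h2.trans (mul_le_mul_of_nonneg_left (sum_one_div_cos_chebAngle_sq_le k)
      (by positivity))
    push_cast at h3
    -- With `N/2 = k` the estimates read `k ∑ c_t² ≤ 4‖L‖² · 16k²`.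
    refine le_of_mul_le_mul_left ?_ hk'
    nlinarith

end LowPart

/-! ### Even Chebyshev polynomials from shallow parallel circuits. -/

section Expansions

open Polynomial.Chebyshev (T)

/-- `f` is a finite linear combination of members of `F` whose coefficients have absolute values
summing to at most `Λ`. -/
def HasExpansion (F : Set (ℝ → ℝ)) (Λ : ℝ) (f : ℝ → ℝ) : Prop :=
  ∃ (ι : Type) (_ : Fintype ι) (w : ι → ℝ) (g : ι → ℝ → ℝ),
    (∀ l, g l ∈ F) ∧ ∑ l, |w l| ≤ Λ ∧ ∀ x, f x = ∑ l, w l * g l x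

namespace HasExpansion

variable {F G : Set (ℝ → ℝ)} {f g : ℝ → ℝ} {Λ Λ' : ℝ}

lemma mono (h : HasExpansion F Λ f) (hΛ : Λ ≤ Λ') : HasExpansion F Λ' f := by
  obtain ⟨ι, hι, w, g, hg, hw, hf⟩ := h
  exact ⟨ι, hι, w, g, hg, hw.trans hΛ, hf⟩

lemma of_mem (h : f ∈ F) : HasExpansion F 1 f :=
  ⟨Unit, inferInstance, fun _ => 1, fun _ => f, fun _ => h, by simp, by simp⟩

lemma zero : HasExpansion F 0 fun _ => 0 :=
  ⟨Empty, inferInstance, fun _ => 0, fun _ _ => 0, fun l => l.elim, by simp, by simp⟩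

lemma congr (h : HasExpansion F Λ f) (hfg : ∀ x, g x = f x) : HasExpansion F Λ g := by
  rwa [funext hfg]

lemma add (hf : HasExpansion F Λ f) (hg : HasExpansion F Λ' g) :
    HasExpansion F (Λ + Λ') fun x => f x + g x := by
  obtain ⟨ι, hι, w, u, hu, hw, hf⟩ := hf
  obtain ⟨ι', hι', w', u', hu', hw', hg⟩ := hg
  refine ⟨ι ⊕ ι', inferInstance, Sum.elim w w', Sum.elim u u', ?_, ?_, fun x => ?_⟩
  · rintro (l | l)
    · exact hu l
    · exact hu' l
  · simpa using add_le_add hw hw'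
  · simp [hf, hg]

lemma const_mul (c : ℝ) (hf : HasExpansion F Λ f) :
    HasExpansion F (|c| * Λ) fun x => c * f x := by
  obtain ⟨ι, hι, w, u, hu, hw, hf⟩ := hf
  refine ⟨ι, hι, fun l => c * w l, u, hu, ?_, fun x => ?_⟩
  · simp only [abs_mul, ← Finset.mul_sum]
    exact mul_le_mul_of_nonneg_left hw (abs_nonneg c)
  · simp only [hf, Finset.mul_sum]
    exact Finset.sum_congr rfl fun l _ => (mul_assoc _ _ _).symm

lemma finset_sum {α : Type*} (s : Finset α) {φ : α → ℝ → ℝ} {B : α → ℝ}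
    (h : ∀ a ∈ s, HasExpansion F (B a) (φ a)) :
    HasExpansion F (∑ a ∈ s, B a) fun x => ∑ a ∈ s, φ a x := by
  classical
  induction s using Finset.induction_on with
  | empty => simpa using zero
  | insert a s ha ih =>
    simp only [Finset.sum_insert ha]
    exact (h a (Finset.mem_insert_self a s)).add
      (ih fun b hb => h b (Finset.mem_insert_of_mem hb))

/-- Substitution into an expansion. -/
lemma comp_mul (hf : HasExpansion F Λ f) (u v : ℝ → ℝ) (hΛ' : 0 ≤ Λ')
    (h : ∀ g ∈ F, HasExpansion G Λ' fun x => g (u x) * v x) :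
    HasExpansion G (Λ * Λ') fun x => f (u x) * v x := by
  obtain ⟨ι, hι, w, g, hg, hw, hf⟩ := hf
  have := finset_sum Finset.univ fun l _ => (h (g l) (hg l)).const_mul (w l)
  refine (this.mono ?_).congr fun x => ?_
  · rw [← Finset.sum_mul]
    exact mul_le_mul_of_nonneg_right hw hΛ'
  · simp only [hf, Finset.sum_mul]
    exact Finset.sum_congr rfl fun l _ => mul_assoc _ _ _

end HasExpansion

/-- The monomials of degree at most `n` with the parity of `n`. -/
def powSet (n : ℕ) : Set (ℝ → ℝ) := {g | ∃ m ≤ n, m % 2 = n % 2 ∧ g = fun x => x ^ m}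

/-- The coefficients of `T_n` have absolute sum at most `(1 + √2)^n`. -/
lemma hasExpansion_T (n : ℕ) :
    HasExpansion (powSet n) ((1 + √2) ^ n) fun x => (T ℝ n).eval x := by
  induction n using Nat.twoStepInduction with
  | zero =>
    refine ((HasExpansion.of_mem (F := powSet 0) (f := fun x => x ^ 0)
      ⟨0, le_rfl, rfl, rfl⟩).mono (by simp)).congr fun x => ?_
    simp
  | one =>
    refine ((HasExpansion.of_mem (F := powSet 1) (f := fun x => x ^ 1)
      ⟨1, le_rfl, rfl, rfl⟩).mono (by simp)).congr fun x => ?_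
    simp
  | more n h0 h1 =>
    have h2 : HasExpansion (powSet (n + 2)) ((1 + √2) ^ n * 1)
        fun x => (T ℝ n).eval x * 1 := by
      refine h0.comp_mul (fun x => x) (fun _ => 1) zero_le_one ?_
      rintro g ⟨m, hm, hmn, rfl⟩
      exact (HasExpansion.of_mem (F := powSet (n + 2)) (f := fun x => x ^ m)
        ⟨m, by omega, by omega, rfl⟩).congr fun x => mul_one _
    have h3 : HasExpansion (powSet (n + 2)) ((1 + √2) ^ (n + 1) * 1)
        fun x => (T ℝ (n + 1 : ℕ)).eval x * x := by
      refine h1.comp_mul (fun x => x) (fun x => x) zero_le_one ?_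
      rintro g ⟨m, hm, hmn, rfl⟩
      exact (HasExpansion.of_mem (F := powSet (n + 2)) (f := fun x => x ^ (m + 1))
        ⟨m + 1, by omega, by omega, rfl⟩).congr
        fun x => (pow_succ x m).symm
    refine (((h3.const_mul 2).add (h2.const_mul (-1))).mono (le_of_eq ?_)).congr fun x => ?_
    -- The absolute sums follow the recurrence `t² = 2t + 1`, whose positive root is `1 + √2`.
    · have : √2 * √2 = 2 := Real.mul_self_sqrt (by norm_num)
      rw [abs_of_pos (by norm_num : (0 : ℝ) < 2), abs_neg, abs_one]
      linear_combination (-(1 + √2) ^ n) * this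
    · push_cast
      rw [Polynomial.Chebyshev.T_add_two]
      simp
      ring

/-- The functions `∏_j (T_{a_j} T_{b_j})²` that the parallel circuit across `k` threads with
query depth `q` gives access to. -/
def parallelSet (k q : ℕ) : Set (ℝ → ℝ) :=
  {g | ∃ a b : Fin k → ℕ, (∀ j, a j + b j ≤ q) ∧
    g = fun x => ∏ j, (chebProd (a j) (b j)).eval x ^ 2}

/-- The first `i` threads carry `T_M` and thread `0` carries `T_r` in addition, so the depth is at
most `M + r`. -/
lemma pow_mul_sq_mem_parallelSet {k q M r i : ℕ} (hk : 0 < k) (hi : i ≤ k) (hq : M + r ≤ q) :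
    (fun x => (T ℝ M).eval x ^ (2 * i) * (T ℝ r).eval x ^ 2) ∈ parallelSet k q := by
  refine ⟨fun j => if (j : ℕ) < i then M else 0, fun j => if (j : ℕ) = 0 then r else 0,
    fun j => ?_, funext fun x => ?_⟩
  · dsimp only
    split_ifs <;> omega
  · have h1 : ∏ j : Fin k, (T ℝ ((if (j : ℕ) < i then M else 0 : ℕ) : ℤ)).eval x ^ 2 =
        (T ℝ M).eval x ^ (2 * i) := by
      rw [Fin.prod_univ_eq_prod_range
        (fun j => (T ℝ ((if j < i then M else 0 : ℕ) : ℤ)).eval x ^ 2) k,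
        ← Finset.prod_subset (Finset.range_mono hi)]
      · rw [Finset.prod_congr rfl fun j hj => by rw [if_pos (Finset.mem_range.mp hj)],
          Finset.prod_const, Finset.card_range, pow_mul]
      · intro j _ hj
        rw [if_neg (by simpa using hj)]
        simp
    have h2 : ∏ j : Fin k, (T ℝ ((if (j : ℕ) = 0 then r else 0 : ℕ) : ℤ)).eval x ^ 2 =
        (T ℝ r).eval x ^ 2 := by
      rw [Fin.prod_univ_eq_prod_range
        (fun j => (T ℝ ((if j = 0 then r else 0 : ℕ) : ℤ)).eval x ^ 2) k,
        Finset.prod_eq_single_of_mem 0 (Finset.mem_range.mpr hk)]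
      · simp
      · intro j _ hj
        simp [hj]
    simp only [chebProd, Polynomial.eval_mul, mul_pow, Finset.prod_mul_distrib, h1, h2]

lemma eval_T_two_mul (r : ℕ) (x : ℝ) :
    (T ℝ (2 * r : ℕ)).eval x = 2 * (T ℝ r).eval x ^ 2 - 1 := by
  have := congrArg (Polynomial.eval x) (Polynomial.Chebyshev.T_mul_T ℝ r r)
  simp only [sub_self, Polynomial.Chebyshev.T_zero, ← two_mul, Polynomial.eval_mul,
    Polynomial.eval_add, Polynomial.eval_one, Polynomial.eval_ofNat] at this
  push_cast
  linear_combination -this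

/-- `T_{2kM} = T_{2k} ∘ T_M` contains only even powers of `T_M`, at most the `2k`-th. The factor `3
= 2 + 1` comes from `T_{2r} = 2 T_r² - 1`. -/
lemma hasExpansion_T_mul_T {k q M r : ℕ} (hk : 0 < k) (hq : M + r ≤ q) :
    HasExpansion (parallelSet k q) (3 * (1 + √2) ^ (2 * k))
      fun x => (T ℝ (2 * k * M : ℕ)).eval x * (T ℝ (2 * r : ℕ)).eval x := by
  have h := (hasExpansion_T (2 * k)).comp_mul (G := parallelSet k q) (Λ' := 3)
    (fun x => (T ℝ M).eval x) (fun x => (T ℝ (2 * r : ℕ)).eval x) (by norm_num) ?_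
  · refine (h.mono (mul_comm _ _).le).congr fun x => ?_
    rw [Nat.cast_mul (2 * k) M, Polynomial.Chebyshev.T_mul, Polynomial.eval_comp]
  · rintro g ⟨m, hm, hm2, rfl⟩
    obtain ⟨i, rfl⟩ : ∃ i, m = 2 * i := ⟨m / 2, by omega⟩
    have h1 := HasExpansion.of_mem (pow_mul_sq_mem_parallelSet (i := i) hk (by omega) hq)
    have h2 := HasExpansion.of_mem
      (pow_mul_sq_mem_parallelSet (r := 0) (q := q) (M := M) (i := i) hk (by omega) (by omega))
    refine (((h1.const_mul 2).add (h2.const_mul (-1))).mono (by norm_num)).congr fun x => ?_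
    simp only [eval_T_two_mul]
    simp
    ring

/-- Even Chebyshev polynomials are combinations of the functions accessible to the parallel
circuit. -/
lemma hasExpansion_T_two_mul {k q : ℕ} (hk : 0 < k) (n : ℕ) (hq : n / k + (k - 1) ≤ q) :
    HasExpansion (parallelSet k q) (6 * ((n / k : ℕ) + 1) * (1 + √2) ^ (2 * k))
      fun x => (T ℝ (2 * n : ℕ)).eval x := by
  have hA : 0 < (1 + √2) ^ (2 * k) := by positivity
  -- If one of `M`, `r` vanishes, then `T_{2n}` itself is the product `T_{2kM} T_{2r}`.
  have base : ∀ M n r : ℕ, n = k * M + r → r = 0 ∨ M = 0 → r < k → M + (k - 1) ≤ q →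
      HasExpansion (parallelSet k q) (3 * (1 + √2) ^ (2 * k))
        fun x => (T ℝ (2 * n : ℕ)).eval x := by
    intro M n r hn h0 hr hMq
    refine (hasExpansion_T_mul_T (q := q) (M := M) (r := r) hk (by omega)).congr fun x => ?_
    rcases h0 with rfl | rfl
    · rw [hn]
      simp [mul_assoc]
    · rw [hn]
      simp
  induction hM : n / k generalizing n with
  | zero =>
    have hlt : n < k := (Nat.div_eq_zero_iff_lt hk).mp hM
    refine (base 0 n n (by simp) (Or.inr rfl) hlt (by omega)).mono ?_
    push_cast
    nlinarith
  | succ M ih =>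
    have hdm := Nat.div_add_mod n k
    have hr := Nat.mod_lt n hk
    rw [hM] at hdm hq
    have hM0 : (0 : ℝ) ≤ M := Nat.cast_nonneg M
    rcases Nat.eq_zero_or_pos (n % k) with h0 | hpos
    · refine (base (M + 1) n (n % k) hdm.symm (Or.inl h0) hr hq).mono ?_
      push_cast
      nlinarith
    -- Reflecting `n` at the multiple `k(M+1)` gives an index with quotient `M`. Each such step adds
    -- weight `2 · 3 = 6`.
    · have hsub : k * (M + 1) - n % k = k * M + (k - n % k) := by
        rw [Nat.mul_succ]
        omega
      have hdiv : (k * (M + 1) - n % k) / k = M := by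
        rw [hsub, Nat.mul_add_div hk, Nat.div_eq_of_lt (by omega), add_zero]
      have h1 := ih (k * (M + 1) - n % k) (by rw [hdiv]; omega) hdiv
      have h2 := hasExpansion_T_mul_T (q := q) (M := M + 1) (r := n % k) hk (by omega)
      refine (((h2.const_mul 2).add (h1.const_mul (-1))).mono (le_of_eq ?_)).congr fun x => ?_
      · rw [abs_of_pos (by norm_num : (0 : ℝ) < 2), abs_neg, abs_one]
        push_cast
        ring
      · have := congrArg (Polynomial.eval x) (Polynomial.Chebyshev.T_mul_T ℝ
          (2 * k * (M + 1) : ℕ) (2 * (n % k) : ℕ))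
        have e1 : ((2 * k * (M + 1) : ℕ) : ℤ) + (2 * (n % k) : ℕ) = (2 * n : ℕ) := by
          rw [← Nat.cast_add]
          congr 1
          linarith
        have e2 : ((2 * k * (M + 1) : ℕ) : ℤ) - (2 * (n % k) : ℕ) =
            (2 * (k * (M + 1) - n % k) : ℕ) := by
          have hle : n % k ≤ k * (M + 1) := hr.le.trans (Nat.le_mul_of_pos_right k (by omega))
          rw [Nat.cast_mul 2 (_ - _), Nat.cast_sub hle]
          push_cast
          ring
        rw [e1, e2] at this
        simp only [Polynomial.eval_mul, Polynomial.eval_add, Polynomial.eval_ofNat] at this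
        linear_combination -this

end Expansions

/-! ### Expansion of the high part. -/

section HighPart

open Polynomial.Chebyshev (T)

lemma coeff_highPart (k : ℕ) (P : ℝ[X]) (n : ℕ) :
    (highPart k P).coeff n = if n < P.natDegree + 1 - k then P.coeff (n + k) else 0 := by
  simp [highPart, Polynomial.finsetSum_coeff, Polynomial.coeff_monomial]

lemma eval_eq_lowPart_add_highPart (k : ℕ) (P : ℝ[X]) (x : ℝ) :
    P.eval x = (lowPart k P).eval x + x ^ k * (highPart k P).eval x := by
  have : P = lowPart k P + highPart k P * Polynomial.X ^ k := by
    ext n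
    rw [Polynomial.coeff_add, Polynomial.coeff_mul_X_pow', coeff_lowPart]
    by_cases h : n < k
    · rw [if_pos h, if_neg (by omega), add_zero]
    · rw [if_neg h, if_pos (by omega), zero_add, coeff_highPart, Nat.sub_add_cancel (by omega)]
      split_ifs with h2
      · rfl
      · exact Polynomial.coeff_eq_zero_of_natDegree_lt (by omega)
  conv_lhs => rw [this]
  simp [mul_comm]

lemma HasDefiniteParity.coeff_eq_zero {P : ℝ[X]} (hP : HasDefiniteParity P) {n : ℕ}
    (hn : n % 2 ≠ P.natDegree % 2) : P.coeff n = 0 := by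
  have hc : ∀ m, (P.comp (-Polynomial.X)).coeff m = (-1) ^ m * P.coeff m := fun m => by
    rw [show -(Polynomial.X : ℝ[X]) = Polynomial.C (-1) * Polynomial.X by simp,
      Polynomial.comp_C_mul_X_coeff, mul_comm]
  rcases eq_or_ne P 0 with rfl | hP0
  · simp
  have hlead : P.coeff P.natDegree ≠ 0 := Polynomial.leadingCoeff_ne_zero.mpr hP0
  -- The sign of the parity is identified by comparison with the leading coefficient.
  obtain ⟨s, hs⟩ : ∃ s : ℝ, ∀ m, (-1) ^ m * P.coeff m = s * P.coeff m := by
    rcases hP with h | h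
    · exact ⟨1, fun m => by rw [← hc, h, one_mul]⟩
    · exact ⟨-1, fun m => by rw [← hc, h]; simp⟩
  have h1 := mul_right_cancel₀ hlead (hs P.natDegree)
  have h2 := hs n
  rw [← h1] at h2
  rcases Nat.even_or_odd n with he | ho
  · have : Odd P.natDegree := by
      rw [Nat.odd_iff]
      rw [Nat.even_iff] at he
      omega
    rw [he.neg_one_pow, this.neg_one_pow] at h2
    linarith
  · have : Even P.natDegree := by
      rw [Nat.even_iff]
      rw [Nat.odd_iff] at ho
      omega
    rw [ho.neg_one_pow, this.neg_one_pow] at h2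
    linarith

lemma eval_neg_highPart {P : ℝ[X]} (hP : HasDefiniteParity P) {k : ℕ}
    (hk : k % 2 = P.natDegree % 2) (x : ℝ) :
    (highPart k P).eval (-x) = (highPart k P).eval x := by
  rw [Polynomial.eval_eq_sum_range, Polynomial.eval_eq_sum_range]
  refine Finset.sum_congr rfl fun n _ => ?_
  rcases Nat.even_or_odd n with he | ho
  · rw [he.neg_pow]
  · have : (highPart k P).coeff n = 0 := by
      rw [coeff_highPart]
      split_ifs
      · rw [Nat.odd_iff] at ho
        exact hP.coeff_eq_zero (by omega)
      · rfl
    rw [this]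
    simp

lemma hasExpansion_highPart {P : ℝ[X]} (hP : HasDefiniteParity P) {k q : ℕ} (hk : 0 < k)
    (hkd : k ≤ P.natDegree) (hpar : k % 2 = P.natDegree % 2)
    (hq : (P.natDegree - k) / (2 * k) + (k - 1) ≤ q) :
    HasExpansion (parallelSet k q)
      (12 * unitNorm (highPart k P) * (1 + √2) ^ (2 * k) * P.natDegree ^ 2 / k)
      fun x => (highPart k P).eval x := by
  set d := P.natDegree with hd
  set H := highPart k P with hH
  set A := (1 + √2) ^ (2 * k) with hA
  have hA0 : 0 < A := by positivity
  have hk' : (0 : ℝ) < k := by exact_mod_cast hk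
  have hN := unitNorm_nonneg H
  obtain ⟨c, hc, hcle⟩ := exists_eq_sum_T_abs_le (d + 1 - k) H (by
    rw [Polynomial.degree_lt_iff_coeff_zero]
    intro m hm
    rw [hH, coeff_highPart, if_neg (by omega)])
  have hHx : ∀ x, H.eval x = ∑ t ∈ Finset.range (d + 1 - k), c t * (T ℝ t).eval x := by
    intro x
    conv_lhs => rw [hc]
    rw [Polynomial.eval_finsetSum]
    simp
  -- The factor `(1 + (-1)^t)/2` removes odd `t`. For `t = 2n` the weight is at most `2‖H‖ · 6(n/k +
  -- 1)A`, and `n/k + 1 ≤ d/k` because `2n + k ≤ d`.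
  have hterm : ∀ t ∈ Finset.range (d + 1 - k), HasExpansion (parallelSet k q)
      (12 * unitNorm H * A * d / k) fun x => c t * ((1 + (-1) ^ t) / 2 * (T ℝ t).eval x) := by
    intro t ht
    have ht' := Finset.mem_range.mp ht
    rcases Nat.even_or_odd' t with ⟨n, rfl | rfl⟩
    · have hn : n / k ≤ (d - k) / (2 * k) := by
        rw [← Nat.div_div_eq_div_mul]
        exact Nat.div_le_div_right (by omega)
      have hnk : ((n / k : ℕ) : ℝ) + 1 ≤ d / k := by
        have h1 : (n / k + 1) * k ≤ d := by
          have := Nat.div_mul_le_self n k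
          rw [Nat.succ_mul]
          omega
        rw [le_div_iff₀ hk']
        exact_mod_cast h1
      refine (((hasExpansion_T_two_mul hk n (by omega)).const_mul (c (2 * n))).mono ?_).congr
        fun x => ?_
      · have h1 := hcle (2 * n) ht'
        calc |c (2 * n)| * (6 * ((n / k : ℕ) + 1) * A)
            ≤ (2 * unitNorm H) * (6 * (d / k) * A) := by gcongr
          _ = 12 * unitNorm H * A * d / k := by ring
      · simp
    · refine (HasExpansion.zero.mono (by positivity)).congr fun x => ?_
      simp [pow_succ]
  refine ((HasExpansion.finset_sum _ hterm).mono ?_).congr fun x => ?_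
  · rw [Finset.sum_const, Finset.card_range, nsmul_eq_mul]
    have : ((d + 1 - k : ℕ) : ℝ) ≤ d := by exact_mod_cast (by omega : d + 1 - k ≤ d)
    calc ((d + 1 - k : ℕ) : ℝ) * (12 * unitNorm H * A * d / k)
        ≤ d * (12 * unitNorm H * A * d / k) := by gcongr
      _ = 12 * unitNorm H * A * d ^ 2 / k := by ring
  · have h1 : H.eval x = (H.eval x + H.eval (-x)) / 2 := by
      rw [eval_neg_highPart hP hpar]
      ring
    rw [h1, hHx, hHx, ← Finset.sum_add_distrib, Finset.sum_div]
    refine Finset.sum_congr rfl fun t _ => ?_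
    have h2 : (T ℝ t).eval (-x) = (-1) ^ t * (T ℝ t).eval x := by
      rw [Polynomial.Chebyshev.T_eval_neg]
      rcases Nat.even_or_odd t with he | ho
      · rw [Int.negOnePow_even _ (by exact_mod_cast he), he.neg_one_pow]
        simp
      · rw [Int.negOnePow_odd _ (by exact_mod_cast ho), ho.neg_one_pow]
        simp
    rw [h2]
    ring

end HighPart

/-! ### Moments of sums of independent variables and Chebyshev's inequality. -/

section ProductDistributions

variable {α : Type*} [Fintype α]

lemma sum_prod_mul_cons {n : ℕ} (q : Fin (n + 1) → α → ℝ) (F : (Fin (n + 1) → α) → ℝ) :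
    ∑ r, (∏ i, q i (r i)) * F r =
      ∑ x, q 0 x * ∑ r : Fin n → α, (∏ i, q i.succ (r i)) * F (Fin.cons x r) := by
  rw [← (Fin.consEquiv fun _ => α).sum_comp, Fintype.sum_prod_type]
  refine Finset.sum_congr rfl fun x _ => ?_
  rw [Finset.mul_sum]
  refine Finset.sum_congr rfl fun r _ => ?_
  rw [Fin.prod_univ_succ, ← mul_assoc]
  rfl

lemma sum_prod_eq_one {n : ℕ} {q : Fin n → α → ℝ} (hq : ∀ i, ∑ x, q i x = 1) :
    ∑ r : Fin n → α, ∏ i, q i (r i) = 1 := by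
  rw [← Fintype.piFinset_univ, ← Finset.prod_univ_sum]
  simp [hq]

lemma sum_prod_mul_sum {n : ℕ} {q : Fin n → α → ℝ} (hq : ∀ i, ∑ x, q i x = 1)
    (h : Fin n → α → ℝ) :
    ∑ r : Fin n → α, (∏ i, q i (r i)) * ∑ i, h i (r i) = ∑ i, ∑ x, q i x * h i x := by
  induction n with
  | zero => simp
  | succ n ih =>
    rw [sum_prod_mul_cons, Fin.sum_univ_succ, ← ih fun i => hq i.succ]
    simp only [Fin.sum_univ_succ, Fin.cons_zero, Fin.cons_succ, mul_add, Finset.sum_add_distrib,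
      ← Finset.sum_mul, sum_prod_eq_one fun i : Fin n => hq i.succ, hq, one_mul]

/-- The second moment of a sum of independent variables, all but possibly the first of which are
centred. -/
lemma sum_prod_mul_sum_sq {n : ℕ} {q : Fin n → α → ℝ} (hq : ∀ i, ∑ x, q i x = 1)
    {h : Fin n → α → ℝ} (hh : ∀ i : Fin n, (i : ℕ) ≠ 0 → ∑ x, q i x * h i x = 0) :
    ∑ r : Fin n → α, (∏ i, q i (r i)) * (∑ i, h i (r i)) ^ 2 =
      ∑ i, ∑ x, q i x * h i x ^ 2 := by
  induction n with
  | zero => simp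
  | succ n ih =>
    have hh' : ∀ i : Fin n, ∑ x, q i.succ x * h i.succ x = 0 := fun i => hh i.succ (by simp)
    have hq' : ∀ i : Fin n, ∑ x, q i.succ x = 1 := fun i => hq i.succ
    rw [sum_prod_mul_cons, Fin.sum_univ_succ, ← ih hq' fun i _ => hh' i]
    have h1 := sum_prod_mul_sum hq' fun i => h i.succ
    rw [Finset.sum_eq_zero fun i _ => hh' i] at h1
    have h2 : ∀ x, ∑ r : Fin n → α, (∏ i, q i.succ (r i)) *
        (∑ i, h i ((Fin.cons x r : Fin (n + 1) → α) i)) ^ 2 =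
        h 0 x ^ 2 + ∑ r : Fin n → α, (∏ i, q i.succ (r i)) * (∑ i, h i.succ (r i)) ^ 2 := by
      intro x
      have h3 : ∀ r : Fin n → α, (∏ i, q i.succ (r i)) *
          (∑ i, h i ((Fin.cons x r : Fin (n + 1) → α) i)) ^ 2 =
          (∏ i, q i.succ (r i)) * h 0 x ^ 2 +
            ((∏ i, q i.succ (r i)) * ∑ i, h i.succ (r i)) * (2 * h 0 x) +
            (∏ i, q i.succ (r i)) * (∑ i, h i.succ (r i)) ^ 2 := by
        intro r
        rw [Fin.sum_univ_succ]
        simp only [Fin.cons_zero, Fin.cons_succ]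
        ring
      rw [Finset.sum_congr rfl fun r _ => h3 r, Finset.sum_add_distrib, Finset.sum_add_distrib,
        ← Finset.sum_mul, ← Finset.sum_mul, h1, sum_prod_eq_one hq']
      ring
    simp only [h2, mul_add, Finset.sum_add_distrib, ← Finset.sum_mul, hq, one_mul]

open Classical in
/-- Chebyshev's inequality for the mean of independent samples. -/
lemma two_thirds_le_sum_prod {q h : α → ℝ} (hq0 : ∀ x, 0 ≤ q x) (hq : ∑ x, q x = 1)
    (hh : ∑ x, q x * h x = 0) {V ε : ℝ} (hV : ∑ x, q x * h x ^ 2 ≤ V) {n : ℕ} (hn : 0 < n)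
    (hε : 0 < ε) (hnV : 3 * V ≤ n * ε ^ 2) :
    2 / 3 ≤ ∑ r : Fin n → α, if |1 / n * ∑ i, h (r i)| ≤ ε then ∏ i, q (r i) else 0 := by
  have hn' : (0 : ℝ) < n := by exact_mod_cast hn
  have hsq := sum_prod_mul_sum_sq (n := n) (q := fun _ => q) (h := fun _ => h) (fun _ => hq)
    fun _ _ => hh
  rw [Finset.sum_const, Finset.card_univ, Fintype.card_fin, nsmul_eq_mul] at hsq
  have htot := sum_prod_eq_one (n := n) (q := fun _ => q) fun _ => hq
  -- Outside the event the squared sum is at least `n²ε²`, so Markov's inequality applies to each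
  -- record.
  have hle : ∀ r : Fin n → α, (∏ i, q (r i)) -
      (if |1 / n * ∑ i, h (r i)| ≤ ε then ∏ i, q (r i) else 0) ≤
        (∏ i, q (r i)) * (∑ i, h (r i)) ^ 2 * (1 / (n ^ 2 * ε ^ 2)) := by
    intro r
    have hp : 0 ≤ ∏ i, q (r i) := Finset.prod_nonneg fun i _ => hq0 _
    split_ifs with hr
    · rw [sub_self]
      positivity
    · rw [sub_zero, mul_assoc]
      refine le_mul_of_one_le_right hp ?_
      have h1 := pow_le_pow_left₀ hε.le (not_le.mp hr).le 2
      rw [sq_abs, mul_pow, one_div_pow] at h1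
      rw [mul_one_div, one_le_div (by positivity)]
      rw [one_div_mul_eq_div, le_div_iff₀ (by positivity)] at h1
      linarith
  have hs := Finset.sum_le_sum fun r (_ : r ∈ Finset.univ) => hle r
  rw [Finset.sum_sub_distrib, htot, ← Finset.sum_mul, hsq] at hs
  have hfin : n * (∑ x, q x * h x ^ 2) * (1 / (n ^ 2 * ε ^ 2)) ≤ 1 / 3 := by
    rw [mul_one_div, div_le_iff₀ (by positivity)]
    nlinarith [mul_le_mul_of_nonneg_left hV hn'.le]
  linarith

end ProductDistributions

/-! ### Mean and variance of a single run. -/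

section SingleRun

/-- Mean and variance of the estimator of a run, in which the first test is chosen at random and
the others are fixed. -/
lemma run_moments {ι : Type*} [Fintype ι] {k : ℕ} {p s η : ι → ℝ} {c m : Fin k → ℝ} {Λ μ : ℝ}
    {Q : ι → Fin (k + 1) → SignType → ℝ} (hp0 : ∀ l, 0 ≤ p l) (hp : ∑ l, p l = 1)
    (hs : ∀ l, |s l| ≤ 1) (hQ0 : ∀ l t o, 0 ≤ Q l t o) (hQ : ∀ l t, ∑ o, Q l t o = 1)
    (hη : ∀ l, ∑ o, Q l 0 o * (o : ℝ) = η l)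
    (hm : ∀ l t, ∑ o, Q l t.succ o * (o : ℝ) = m t)
    (hμ : μ = Λ * ∑ l, p l * (s l * η l)) :
    (∑ x : ι × (Fin (k + 1) → SignType), (p x.1 * ∏ t, Q x.1 t (x.2 t)) *
      ((Λ * s x.1 * (x.2 0 : ℝ) + ∑ t : Fin k, c t * (x.2 t.succ : ℝ)) -
        (μ + ∑ t, c t * m t)) = 0) ∧
    ∑ x : ι × (Fin (k + 1) → SignType), (p x.1 * ∏ t, Q x.1 t (x.2 t)) *
      ((Λ * s x.1 * (x.2 0 : ℝ) + ∑ t : Fin k, c t * (x.2 t.succ : ℝ)) -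
        (μ + ∑ t, c t * m t)) ^ 2 ≤ Λ ^ 2 + ∑ t, c t ^ 2 := by
  set h : ι → Fin (k + 1) → SignType → ℝ := fun l =>
    Fin.cons (fun o => Λ * s l * (o : ℝ) - μ) fun t o => c t * ((o : ℝ) - m t) with hh
  have hsum : ∀ (l : ι) (o : Fin (k + 1) → SignType),
      (Λ * s l * (o 0 : ℝ) + ∑ t : Fin k, c t * (o t.succ : ℝ)) - (μ + ∑ t, c t * m t) =
        ∑ t, h l t (o t) := by
    intro l o
    rw [Fin.sum_univ_succ]
    simp only [hh, Fin.cons_zero, Fin.cons_succ, mul_sub, Finset.sum_sub_distrib]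
    ring
  -- For a fixed label the first variable need not be centred, as `μ` is a mean over labels too.
  -- This is why `sum_prod_mul_sum_sq` exempts index `0`.
  have h0 : ∀ l, ∑ o, Q l 0 o * h l 0 o = Λ * (s l * η l) - μ := by
    intro l
    simp only [hh, Fin.cons_zero, mul_sub, Finset.sum_sub_distrib, ← Finset.sum_mul, hQ, one_mul]
    rw [← hη, Finset.mul_sum, Finset.mul_sum]
    congr 1
    exact Finset.sum_congr rfl fun o _ => by ring
  have hsucc : ∀ l (t : Fin k), ∑ o, Q l t.succ o * h l t.succ o = 0 := by
    intro l t
    have : ∀ o, Q l t.succ o * h l t.succ o =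
        c t * (Q l t.succ o * (o : ℝ)) - Q l t.succ o * (c t * m t) := by
      intro o
      simp only [hh, Fin.cons_succ]
      ring
    simp only [this, Finset.sum_sub_distrib, ← Finset.mul_sum, ← Finset.sum_mul, hQ, hm]
    ring
  have hsq : ∀ l t, ∑ o, Q l t o * (o : ℝ) ^ 2 ≤ 1 := by
    intro l t
    rw [← hQ l t]
    refine Finset.sum_le_sum fun o _ => mul_le_of_le_one_right (hQ0 l t o) ?_
    cases o <;> simp
  have h0sq : ∀ l, ∑ o, Q l 0 o * h l 0 o ^ 2 ≤ Λ ^ 2 - 2 * μ * (Λ * (s l * η l)) + μ ^ 2 := by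
    intro l
    have : ∀ o, Q l 0 o * h l 0 o ^ 2 = (Λ * s l) ^ 2 * (Q l 0 o * (o : ℝ) ^ 2) -
        2 * μ * (Λ * s l) * (Q l 0 o * (o : ℝ)) + Q l 0 o * μ ^ 2 := by
      intro o
      simp only [hh, Fin.cons_zero]
      ring
    simp only [this, Finset.sum_sub_distrib, Finset.sum_add_distrib, ← Finset.mul_sum,
      ← Finset.sum_mul, hQ, hη]
    have h1 : (Λ * s l) ^ 2 * ∑ o, Q l 0 o * (o : ℝ) ^ 2 ≤ (Λ * s l) ^ 2 * 1 :=
      mul_le_mul_of_nonneg_left (hsq l 0) (sq_nonneg _)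
    have h2 : s l ^ 2 ≤ 1 := (sq_le_one_iff_abs_le_one _).mpr (hs l)
    nlinarith [mul_le_mul_of_nonneg_left h2 (sq_nonneg Λ)]
  have hsuccsq : ∀ l (t : Fin k), ∑ o, Q l t.succ o * h l t.succ o ^ 2 ≤ c t ^ 2 := by
    intro l t
    have : ∀ o, Q l t.succ o * h l t.succ o ^ 2 = c t ^ 2 * (Q l t.succ o * (o : ℝ) ^ 2) -
        2 * m t * c t ^ 2 * (Q l t.succ o * (o : ℝ)) + Q l t.succ o * (c t * m t) ^ 2 := by
      intro o
      simp only [hh, Fin.cons_succ]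
      ring
    simp only [this, Finset.sum_sub_distrib, Finset.sum_add_distrib, ← Finset.mul_sum,
      ← Finset.sum_mul, hQ, hm]
    nlinarith [mul_le_mul_of_nonneg_left (hsq l t.succ) (sq_nonneg (c t)),
      sq_nonneg (c t * m t)]
  have hμ' : ∑ l, p l * (Λ * (s l * η l)) = μ := by
    rw [hμ, Finset.mul_sum]
    exact Finset.sum_congr rfl fun l _ => by ring
  simp only [Fintype.sum_prod_type, hsum]
  simp only [mul_assoc (p _), ← Finset.mul_sum]
  constructor
  · simp only [sum_prod_mul_sum (hQ _)]
    simp only [Fin.sum_univ_succ, h0, hsucc, Finset.sum_const_zero, add_zero, mul_sub,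
      Finset.sum_sub_distrib, hμ', ← Finset.sum_mul, hp]
    ring
  · have hl : ∀ l, p l * ∑ o : Fin (k + 1) → SignType, (∏ t, Q l t (o t)) *
        (∑ t, h l t (o t)) ^ 2 ≤
        p l * (Λ ^ 2 + μ ^ 2 + ∑ t, c t ^ 2) - 2 * μ * (p l * (Λ * (s l * η l))) := by
      intro l
      rw [sum_prod_mul_sum_sq (hQ l), Fin.sum_univ_succ]
      · have h1 := Finset.sum_le_sum fun t (_ : t ∈ Finset.univ) => hsuccsq l t
        have h2 := mul_le_mul_of_nonneg_left (add_le_add (h0sq l) h1) (hp0 l)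
        linarith
      · intro t ht
        obtain ⟨t, rfl⟩ := Fin.exists_succ_eq.mpr (fun h0 : t = 0 => ht (by simp [h0]))
        exact hsucc l t
    -- Averaging over labels turns `-2μ Λ s η + μ²` into `-μ²`, which can be dropped.
    refine (Finset.sum_le_sum fun l _ => hl l).trans ?_
    rw [Finset.sum_sub_distrib, ← Finset.sum_mul, hp, ← Finset.mul_sum, hμ']
    nlinarith [sq_nonneg μ]

end SingleRun

/-! ### From expansions to random signed products. -/

section Sampling

/-- An expansion as the expectation of a signed random member of `parallelSet k q`. -/
lemma HasExpansion.exists_sampling {k q : ℕ} {Λ : ℝ} {f : ℝ → ℝ}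
    (hf : HasExpansion (parallelSet k q) Λ f) :
    ∃ (n : ℕ) (p s : Fin n → ℝ) (a b : Fin n → Fin k → ℕ), (∀ l, 0 ≤ p l) ∧ ∑ l, p l = 1 ∧
      (∀ l, |s l| ≤ 1) ∧ (∀ l j, a l j + b l j ≤ q) ∧
      ∀ x, f x = Λ * ∑ l, p l * (s l * ∏ j, (chebProd (a l j) (b l j)).eval x ^ 2) := by
  obtain ⟨ι, hι, w, g, hg, hw, hf⟩ := hf
  choose a b hab hgab using hg
  have hΛ : 0 ≤ Λ := (Finset.sum_nonneg fun l _ => abs_nonneg (w l)).trans hw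
  -- The additional label `none`, with sign `0`, absorbs the probability left over when the weights
  -- sum to less than `Λ`. It carries all the mass when `Λ = 0`, where the quotients are zero by
  -- convention.
  let p : Option ι → ℝ := fun o => o.elim (1 - ∑ l, |w l| / Λ) fun l => |w l| / Λ
  let s : Option ι → ℝ := fun o => o.elim 0 fun l => (SignType.sign (w l) : ℝ)
  let a' : Option ι → Fin k → ℕ := fun o => o.elim 0 a
  let b' : Option ι → Fin k → ℕ := fun o => o.elim 0 b
  let e := Fintype.equivFin (Option ι)
  refine ⟨Fintype.card (Option ι), p ∘ e.symm, s ∘ e.symm, a' ∘ e.symm, b' ∘ e.symm,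
    fun l => ?_, ?_, fun l => ?_, fun l j => ?_, fun x => ?_⟩
  · simp only [Function.comp_apply]
    rcases e.symm l with _ | l
    · simp only [p, Option.elim_none, ← Finset.sum_div, sub_nonneg]
      exact div_le_one_of_le₀ hw hΛ
    · simp only [p, Option.elim_some]
      positivity
  · rw [← e.sum_comp]
    simp [Fintype.sum_option, p]
  · simp only [Function.comp_apply]
    rcases e.symm l with _ | l
    · simp [s]
    · simp only [s, Option.elim_some]
      cases SignType.sign (w l) <;> simp
  · simp only [Function.comp_apply]
    rcases e.symm l with _ | l
    · simp [a', b']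
    · exact hab l j
  · rw [← e.sum_comp]
    simp only [Function.comp_apply, Equiv.symm_apply_apply, Fintype.sum_option, p, s, a', b',
      Option.elim_none, Option.elim_some, zero_mul, mul_zero, zero_add, hf, Finset.mul_sum, hgab]
    refine Finset.sum_congr rfl fun l _ => ?_
    rcases hΛ.eq_or_lt with h0 | hpos
    · have : |w l| ≤ 0 := by
        rw [h0]
        exact (Finset.single_le_sum (fun l _ => abs_nonneg (w l)) (Finset.mem_univ l)).trans hw
      rw [← h0, abs_nonpos_iff.mp this]
      simp
    · rw [← mul_assoc, ← mul_assoc, mul_div_cancel₀ _ hpos.ne', abs_mul_sign]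

end Sampling

/-! ### The protocol, its resources and its success probability. -/

section Protocol

/-- Each run performs side by side a parallel test, drawn at random, and the Hadamard tests of
`T_0, …, T_{k-1}`; the estimate is an average of linear functions of the outcomes. -/
noncomputable def traceProtocol {k L : ℕ} (runs : ℕ) (p s : Fin L → ℝ) (hp0 : ∀ l, 0 ≤ p l)
    (hp : ∑ l, p l = 1) (a b : Fin L → Fin k → ℕ) (c : Fin k → ℝ) (Λ const : ℝ) :
    QSPProtocol k where
  runs := runs
  labels := L
  tests := k + 1
  weight := fun _ => p
  weight_nonneg := fun _ => hp0
  weight_sum := fun _ => hp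
  circuit := fun _ l => Fin.cons (.parallel fun j => chebSeq (a l j) (b l j))
    fun t => .hadamard (chebSeq t 0)
  estimate := fun r => const + 1 / runs * ∑ i, (Λ * s (r i).1 * ((r i).2 0 : ℝ) +
    ∑ t : Fin k, c t * ((r i).2 t.succ : ℝ))

variable {k L : ℕ} {runs : ℕ} {p s : Fin L → ℝ} {hp0 : ∀ l, 0 ≤ p l}
  {hp : ∑ l, p l = 1} {a b : Fin L → Fin k → ℕ} {c : Fin k → ℝ} {Λ const : ℝ}

lemma traceProtocol_widthLE (hk : 0 < k) :
    (traceProtocol runs p s hp0 hp a b c Λ const).WidthLE (8 * k) := by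
  intro n l
  have h : (∑ t, ((traceProtocol runs p s hp0 hp a b c Λ const).circuit n l t).width) =
      3 * k + 1 + k * 4 := by
    refine (Fin.sum_univ_succ (n := k) _).trans ?_
    simp [traceProtocol, QSPTest.width]
  rw [h]
  have : (1 : ℝ) ≤ k := by exact_mod_cast hk
  push_cast
  linarith

/-- The Hadamard tests reach `T_{k-1}`, hence the condition `k ≤ q + 1`. -/
lemma traceProtocol_queryDepthLE {q : ℕ} (hab : ∀ l j, a l j + b l j ≤ q) (hkq : k ≤ q + 1) :
    (traceProtocol runs p s hp0 hp a b c Λ const).QueryDepthLE q := by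
  intro n l t
  refine Fin.cases ?_ (fun t => ?_) t
  · exact Finset.sup_le fun j _ => hab l j
  · have := t.isLt
    change (t : ℕ) + 0 ≤ q
    omega

lemma two_thirds_le_successProb_traceProtocol {A S : Type*} [Fintype A] [DecidableEq A]
    [Fintype S] [DecidableEq S] {a₀ : A} {U : Matrix (A × S) (A × S) ℂ} {ρ : Matrix S S ℂ}
    (hρ : IsDensityMatrix ρ) (hU : IsBlockEncoding a₀ U ρ) (hk : 0 < k) (hs : ∀ l, |s l| ≤ 1)
    {P : ℝ[X]} {ε : ℝ} (hε : 0 < ε) (hruns : 0 < runs)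
    (hV : 3 * (Λ ^ 2 + ∑ t, c t ^ 2) ≤ runs * ε ^ 2)
    (hP : ∀ x, P.eval x = P.coeff 0 + x * ∑ t, c t * (chebProd t 0).eval x +
      x ^ k * (Λ * ∑ l, p l * (s l * ∏ j, (chebProd (a l j) (b l j)).eval x ^ 2))) :
    2 / 3 ≤ (traceProtocol runs p s hp0 hp a b c Λ (Fintype.card S * P.coeff 0)).successProb
      a₀ U ρ (Polynomial.aeval ρ P).trace ε := by
  obtain ⟨lam, hlam⟩ := hρ.exists_isSpectrum
  set test : Fin L → Fin (k + 1) → QSPTest k := fun l =>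
    Fin.cons (.parallel fun j => chebSeq (a l j) (b l j)) fun t => .hadamard (chebSeq t 0)
    with htest
  set Q : Fin L → Fin (k + 1) → SignType → ℝ := fun l t => (test l t).prob a₀ U ρ with hQ
  set η : Fin L → ℝ := fun l =>
    ∑ i, lam i ^ k * ∏ j, (chebProd (a l j) (b l j)).eval (lam i) ^ 2 with hη
  set m : Fin k → ℝ := fun t => ∑ i, lam i * (chebProd t 0).eval (lam i) with hm
  set μ : ℝ := Λ * ∑ l, p l * (s l * η l) with hμ
  have hmean0 : ∀ l, (test l 0).HasMean a₀ U ρ (η l) := fun l =>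
    hlam.hasMean_parallel_chebSeq hU hk (a l) (b l)
  have hmean : ∀ l (t : Fin k), (test l t.succ).HasMean a₀ U ρ (m t) := fun l t =>
    hlam.hasMean_hadamard_chebSeq hU t 0
  have hQ0 : ∀ l t o, 0 ≤ Q l t o := fun l t =>
    Fin.cases (hmean0 l).nonneg (fun t => (hmean l t).nonneg) t
  have hQ1 : ∀ l t, ∑ o, Q l t o = 1 := fun l t =>
    Fin.cases (hmean0 l).sum_eq_one (fun t => (hmean l t).sum_eq_one) t
  obtain ⟨hE, hVar⟩ := run_moments (c := c) (m := m) (Λ := Λ) (μ := μ) hp0 hp hs hQ0 hQ1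
    (fun l => (hmean0 l).mean) (fun l t => (hmean l t).mean) hμ
  have htrace : (Polynomial.aeval ρ P).trace =
      ((Fintype.card S * P.coeff 0 + (μ + ∑ t, c t * m t) : ℝ) : ℂ) := by
    rw [hlam.trace_aeval]
    congr 1
    have h1 : ∑ i, lam i * ∑ t, c t * (chebProd t 0).eval (lam i) = ∑ t, c t * m t := by
      simp only [hm, Finset.mul_sum]
      rw [Finset.sum_comm]
      exact Finset.sum_congr rfl fun t _ => Finset.sum_congr rfl fun i _ => by ring
    have h2 : ∑ i, lam i ^ k * (Λ * ∑ l, p l *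
        (s l * ∏ j, (chebProd (a l j) (b l j)).eval (lam i) ^ 2)) = μ := by
      simp only [hμ, hη, Finset.mul_sum]
      rw [Finset.sum_comm]
      exact Finset.sum_congr rfl fun t _ => Finset.sum_congr rfl fun i _ => by ring
    simp only [hP, Finset.sum_add_distrib, h1, h2, Finset.sum_const, Finset.card_univ,
      nsmul_eq_mul]
    ring
  have hq0 : ∀ x : Fin L × (Fin (k + 1) → SignType), 0 ≤ p x.1 * ∏ t, Q x.1 t (x.2 t) :=
    fun x => mul_nonneg (hp0 _) (Finset.prod_nonneg fun t _ => hQ0 _ _ _)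
  have hq1 : ∑ x : Fin L × (Fin (k + 1) → SignType), p x.1 * ∏ t, Q x.1 t (x.2 t) = 1 := by
    rw [Fintype.sum_prod_type]
    simp only [← Finset.mul_sum, sum_prod_eq_one (hQ1 _), mul_one, hp]
  refine (two_thirds_le_sum_prod hq0 hq1 hE hVar hruns hε hV).trans (le_of_eq ?_)
  rw [QSPProtocol.successProb]
  refine Finset.sum_congr rfl fun r _ => ?_
  have hr' : (0 : ℝ) < runs := by exact_mod_cast hruns
  -- The error of the estimate is the absolute mean of the centred run estimators, the quantity in
  -- Chebyshev's inequality.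
  have hest : ‖(((traceProtocol runs p s hp0 hp a b c Λ
      (Fintype.card S * P.coeff 0)).estimate r : ℝ) : ℂ) - (Polynomial.aeval ρ P).trace‖ =
      |1 / (runs : ℝ) * ∑ i, ((Λ * s (r i).1 * ((r i).2 0 : ℝ) +
        ∑ t : Fin k, c t * ((r i).2 t.succ : ℝ)) - (μ + ∑ t, c t * m t))| := by
    rw [htrace, ← Complex.ofReal_sub, Complex.norm_real, Real.norm_eq_abs]
    congr 1
    rw [Finset.sum_sub_distrib, Finset.sum_const, Finset.card_univ, Fintype.card_fin,
      nsmul_eq_mul]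
    change Fintype.card S * P.coeff 0 + 1 / (runs : ℝ) * _ - _ = _
    field_simp
    ring
  rw [hest]
  rfl

end Protocol

/-! ### Choice of parameters and constants. -/

theorem theorem5 :
    ∃ C : ℝ, 0 < C ∧
      ∀ (D d k : ℕ) (P : ℝ[X]) (ε : ℝ),
        0 < k → k ≤ d → k % 2 = d % 2 →
        P.natDegree = d → HasDefiniteParity P →
        (∀ x ∈ Set.Icc (-1 : ℝ) 1, |P.eval x| ≤ 1) → 0 < ε →
        ∃ p : QSPProtocol k,
          p.WidthLE (C * k) ∧
          p.QueryDepthLE ((d - k) / (2 * k) + k - 1) ∧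
          p.runs ≤ ⌈C * ((k * unitNorm (lowPart k P) ^ 2 +
              unitNorm (highPart k P) ^ 2 * d ^ 4 * (1 + Real.sqrt 2) ^ (4 * k) / k ^ 2)
                / ε ^ 2)⌉₊ ∧
          ∀ (A : Type) [Fintype A] [DecidableEq A] (a₀ : A)
            (U : Matrix (A × Fin D) (A × Fin D) ℂ) (ρ : Matrix (Fin D) (Fin D) ℂ),
            IsDensityMatrix ρ → IsBlockEncoding a₀ U ρ →
            2 / 3 ≤ p.successProb a₀ U ρ (Polynomial.aeval ρ P).trace ε := by
  -- Here `432 = 3 · 12²`, with `3` from failure probability `1/3` and `12` from `Λ`. The constants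
  -- `64` of the low part and `8` of the width fit below it.
  refine ⟨432, by norm_num, ?_⟩
  intro D d k P ε hk hkd hpar hd hP _ hε
  subst hd
  have hk' : (0 : ℝ) < k := by exact_mod_cast hk
  have hd' : (0 : ℝ) < P.natDegree := by exact_mod_cast hk.trans_le hkd
  obtain ⟨c, hc, hcle⟩ := exists_lowPart_expansion hk P
  obtain ⟨L, p, s, a, b, hp0, hp, hs, hab, hf⟩ :=
    (hasExpansion_highPart hP (q := (P.natDegree - k) / (2 * k) + k - 1) hk hkd hpar
      (Nat.add_sub_assoc hk _).ge).exists_sampling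
  set Λ := 12 * unitNorm (highPart k P) * (1 + √2) ^ (2 * k) * P.natDegree ^ 2 / k with hΛ
  set Y := k * unitNorm (lowPart k P) ^ 2 +
    unitNorm (highPart k P) ^ 2 * P.natDegree ^ 4 * (1 + √2) ^ (4 * k) / k ^ 2 with hY
  -- Since `k ≤ d`, the leading coefficient of `P` belongs to the high part. This makes `Y`, and so
  -- the number of runs, positive.
  have hhigh : 0 < unitNorm (highPart k P) := by
    refine unitNorm_pos fun h => ?_
    have h1 := coeff_highPart k P (P.natDegree - k)
    rw [h, if_pos (by omega), Nat.sub_add_cancel hkd, Polynomial.coeff_zero] at h1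
    have h2 : P = 0 := Polynomial.leadingCoeff_eq_zero.mp h1.symm
    rw [h2] at hkd
    simp at hkd
    omega
  have hYpos : 0 < Y := by positivity
  have hΛY : Λ ^ 2 = 144 * (Y - k * unitNorm (lowPart k P) ^ 2) := by
    rw [hY, hΛ, show 4 * k = 2 * k * 2 by ring, pow_mul _ (2 * k) 2]
    field_simp
    ring
  set runs := ⌈432 * (Y / ε ^ 2)⌉₊ with hrunsdef
  have hruns : 0 < runs := Nat.ceil_pos.mpr (by positivity)
  have hle : 432 * (Y / ε ^ 2) ≤ runs := Nat.le_ceil _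
  have hV : 3 * (Λ ^ 2 + ∑ t : Fin k, c t ^ 2) ≤ runs * ε ^ 2 := by
    rw [Fin.sum_univ_eq_sum_range fun t => c t ^ 2]
    have h1 : 432 * Y ≤ runs * ε ^ 2 := by
      have := mul_le_mul_of_nonneg_right hle (sq_nonneg ε)
      rwa [mul_assoc, div_mul_cancel₀ _ (by positivity)] at this
    have h2 : 0 ≤ k * unitNorm (lowPart k P) ^ 2 := by positivity
    linarith
  -- The known contribution `D a₀` of the constant term is the only place where the dimension enters
  -- the protocol.
  refine ⟨traceProtocol runs p s hp0 hp a b (fun t => c t) Λ (D * P.coeff 0), ?_, ?_, le_rfl, ?_⟩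
  · intro n l
    refine (traceProtocol_widthLE hk n l).trans ?_
    linarith
  · exact traceProtocol_queryDepthLE hab ((Nat.le_add_left k _).trans le_tsub_add)
  · intro A _ _ a₀ U ρ hρ hU
    have := two_thirds_le_successProb_traceProtocol (runs := runs) (hp0 := hp0) (hp := hp)
      (a := a) (b := b) (c := fun t => c t) (Λ := Λ) (P := P) hρ hU hk hs hε hruns hV ?_
    · rwa [Fintype.card_fin] at this
    · intro x
      rw [eval_eq_lowPart_add_highPart k, hc, hf,
        Fin.sum_univ_eq_sum_range fun t => c t * (chebProd t 0).eval x]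
      simp [chebProd]
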